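/- Let $\mathbb D$ be the open unit disc, $\mathbb T$ the unit circle with normalized Lebesgue measure $m$, and let $\Gamma$ be any subgroup of the group of automorphisms of $\mathbb D$, i.e. of the Möbius transformations $z\mapsto\lambda\frac{a-z}{1-\bar a z}$ with $|\lambda|=1$, $|a|<1$, with its usual topology. These maps also act on $\mathbb T$. Let $\hat\Gamma$ be the group (written additively) of continuous homomorphisms $\sigma:\Gamma\to\mathbb T$. For $1\le p\le\infty$ let $H^p=\{f\in L^p(\mathbb T,m):\hat f(n)=0\text{ for all } n<0\}$, whose elements are identified with their holomorphic extensions to $\mathbb D$, and for $\sigma\in\hat\Gamma$ let $$H^p_\sigma=\{f\in H^p: f\circ\gamma=\sigma(\gamma)f\ \text{ a.e. on }\mathbb T\text{ for all }\gamma\in\Gamma\}.$$ **Proposition.** Let $1\le p\le\infty$, $\sigma\in\hat\Gamma$, and let $f\in H^p_\sigma$ be nonzero, with canonical factorization $f=Bsu$, where - $B$ is a Blaschke product (possibly finite or $1$); - $s$ is a singular inner function, that is, $s\in H^\infty$, $|s|=1$ a.e. on $\mathbb T$, and $s$ has no zeros in $\mathbb D$ (unimodular constants are allowed); - $u$ is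 an outer function, that is, for some $1\le q\le\infty$ (for instance $q=p$ or $q=1$) $u\in H^q$ and the closed linear span of $\{z^nu:n\ge0\}$ in $H^q$ is all of $H^q$ (the closure is weak-star if $q=\infty$). Then there exist characters $\sigma_1,\sigma_2,\sigma_3\in\hat\Gamma$ such that $\sigma=\sigma_1+\sigma_2+\sigma_3$, $B\in H^\infty_{\sigma_1}$, $u\in H^1_{\sigma_2}$ and $s\in H^\infty_{\sigma_3}$. -/

import Mathlib

open MeasureTheory Complex Filter
open scoped ENNReal Topology ComplexConjugate Complex.UnitDisc

noncomputable section

namespace CharAut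

/-! ### Automorphisms of the disc, acting on the disc and on the circle -/

/-- The numerator and the denominator of a Moebius automorphism of the disc: the key identity. -/
theorem normSq_den_sub_normSq_num (a z : ℂ) :
    normSq (1 - conj a * z) - normSq (a - z) = (1 - normSq a) * (1 - normSq z) := by
  simp only [normSq_apply, sub_re, sub_im, mul_re, mul_im, conj_re, conj_im, one_re, one_im]
  ring

theorem one_sub_conj_mul_ne_zero (a : 𝔻) {z : ℂ} (hz : ‖z‖ ≤ 1) :
    1 - conj (a : ℂ) * z ≠ 0 := by
  intro h
  have h1 : conj (a : ℂ) * z = 1 := (sub_eq_zero.mp h).symm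
  have h2 : ‖(a : ℂ)‖ * ‖z‖ = 1 := by
    rw [← RCLike.norm_conj (a : ℂ), ← norm_mul, h1, norm_one]
  have h3 := a.norm_lt_one
  nlinarith [norm_nonneg (a : ℂ), norm_nonneg z]

/-- An automorphism of the unit disc, that is, a Moebius transformation
`z ↦ rot * (pt - z) / (1 - conj pt * z)` with `|rot| = 1` and `|pt| < 1`.
The two parameters are determined by the map. -/
@[ext]
structure DiscAut where
  rot : Circle
  pt : 𝔻

namespace DiscAut

/-- The Moebius transformation as a map of the complex plane. -/
def toFun (φ : DiscAut) (z : ℂ) : ℂ :=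
  φ.rot * (φ.pt - z) / (1 - conj (φ.pt : ℂ) * z)

theorem norm_toFun_lt_one (φ : DiscAut) {z : ℂ} (hz : ‖z‖ < 1) : ‖φ.toFun z‖ < 1 := by
  have hd := one_sub_conj_mul_ne_zero φ.pt hz.le
  have hk := normSq_den_sub_normSq_num φ.pt z
  have h1 : normSq z < 1 := by rw [normSq_eq_norm_sq]; nlinarith [norm_nonneg z]
  have h2 := φ.pt.normSq_lt_one
  rw [toFun, norm_div, norm_mul, Circle.norm_coe, one_mul, div_lt_one (norm_pos_iff.mpr hd)]
  refine lt_of_pow_lt_pow_left₀ 2 (norm_nonneg _) ?_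
  rw [← normSq_eq_norm_sq, ← normSq_eq_norm_sq]
  nlinarith [mul_pos (sub_pos.mpr h1) (sub_pos.mpr h2)]

theorem norm_toFun_eq_one (φ : DiscAut) {z : ℂ} (hz : ‖z‖ = 1) : ‖φ.toFun z‖ = 1 := by
  have hd := one_sub_conj_mul_ne_zero φ.pt hz.le
  have hk := normSq_den_sub_normSq_num φ.pt z
  have h1 : normSq z = 1 := by rw [normSq_eq_norm_sq, hz, one_pow]
  rw [toFun, norm_div, norm_mul, Circle.norm_coe, one_mul, div_eq_one_iff_eq (norm_ne_zero_iff.mpr hd)]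
  refine (pow_left_inj₀ (norm_nonneg _) (norm_nonneg _) two_ne_zero).mp ?_
  rw [← normSq_eq_norm_sq, ← normSq_eq_norm_sq]
  rw [h1] at hk
  linarith

/-- An automorphism is determined by its values on the disc. -/
theorem ext_toFun {φ ψ : DiscAut} (h : ∀ z : ℂ, ‖z‖ < 1 → φ.toFun z = ψ.toFun z) : φ = ψ := by
  have hr : ∀ c : Circle, (c : ℂ) ≠ 0 := fun c => c.coe_ne_zero
  have hpt : (φ.pt : ℂ) = ψ.pt := by
    have h0 := h φ.pt φ.pt.norm_lt_one
    have hd := one_sub_conj_mul_ne_zero ψ.pt φ.pt.norm_lt_one.le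
    simp only [toFun, sub_self, mul_zero, zero_div] at h0
    have h1 := (div_eq_zero_iff.mp h0.symm).resolve_right hd
    exact (sub_eq_zero.mp ((mul_eq_zero.mp h1).resolve_left (hr _))).symm
  have hrot : (φ.rot : ℂ) = ψ.rot := by
    obtain ⟨z, hz, hne⟩ : ∃ z : ℂ, ‖z‖ < 1 ∧ (ψ.pt : ℂ) - z ≠ 0 := by
      by_cases h0 : (ψ.pt : ℂ) = 0
      · exact ⟨1 / 2, by norm_num, by rw [h0]; norm_num⟩
      · exact ⟨0, by norm_num, by simpa using h0⟩
    have h1 := h z hz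
    have hd := one_sub_conj_mul_ne_zero ψ.pt hz.le
    simp only [toFun, hpt] at h1
    rw [div_left_inj' hd] at h1
    exact mul_right_cancel₀ hne h1
  exact DiscAut.ext (Subtype.ext hrot) (UnitDisc.coe_injective hpt)

instance : One DiscAut := ⟨⟨-1, 0⟩⟩

theorem toFun_one (z : ℂ) : toFun 1 z = z := by
  change ((-1 : Circle) : ℂ) * (((0 : 𝔻) : ℂ) - z) / (1 - conj ((0 : 𝔻) : ℂ) * z) = z
  simp

instance : Inv DiscAut := ⟨fun φ => ⟨φ.rot⁻¹, φ.rot • φ.pt⟩⟩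

theorem toFun_inv (φ : DiscAut) {z : ℂ} (hz : ‖z‖ ≤ 1) : φ⁻¹.toFun (φ.toFun z) = z := by
  have hd := one_sub_conj_mul_ne_zero φ.pt hz
  have hc : conj (φ.rot : ℂ) * φ.rot = 1 := by
    rw [mul_comm, mul_conj, Circle.normSq_coe, ofReal_one]
  have hr : (φ.rot : ℂ) ≠ 0 := φ.rot.coe_ne_zero
  have hk : (1 : ℂ) - conj (φ.pt : ℂ) * φ.pt ≠ 0 :=
    one_sub_conj_mul_ne_zero φ.pt φ.pt.norm_lt_one.le
  change ((φ.rot⁻¹ : Circle) : ℂ) * (((φ.rot • φ.pt : 𝔻) : ℂ) - φ.toFun z)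
    / (1 - conj ((φ.rot • φ.pt : 𝔻) : ℂ) * φ.toFun z) = z
  rw [UnitDisc.coe_circle_smul, Circle.coe_inv_eq_conj, map_mul, toFun]
  have h1 : (1 : ℂ) - conj (φ.rot : ℂ) * conj (φ.pt : ℂ) *
      (φ.rot * (φ.pt - z) / (1 - conj (φ.pt : ℂ) * z))
      = (1 - conj (φ.pt : ℂ) * φ.pt) / (1 - conj (φ.pt : ℂ) * z) := by
    rw [eq_div_iff hd, sub_mul, mul_assoc, div_mul_cancel₀ _ hd]
    linear_combination (-(conj (φ.pt : ℂ)) * (φ.pt - z)) * hc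
  rw [h1]
  have h2 : conj (φ.rot : ℂ) * (φ.rot * φ.pt - φ.rot * (φ.pt - z) / (1 - conj (φ.pt : ℂ) * z))
      = z * (1 - conj (φ.pt : ℂ) * φ.pt) / (1 - conj (φ.pt : ℂ) * z) := by
    rw [eq_div_iff hd, mul_assoc, sub_mul, div_mul_cancel₀ _ hd]
    linear_combination (z - conj (φ.pt : ℂ) * z * φ.pt) * hc
  rw [h2, div_div_div_cancel_right₀ hd, mul_div_cancel_right₀ _ hk]

theorem conj_eq (φ ψ : DiscAut) :
    conj (1 - conj ((ψ.rot • ψ.pt : 𝔻) : ℂ) * φ.pt) = 1 - conj (φ.pt : ℂ) * (ψ.rot • ψ.pt : 𝔻) := by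
  simp only [map_sub, map_one, map_mul, conj_conj]
  ring

/-- Composition, in terms of the parameters. -/
instance : Mul DiscAut :=
  ⟨fun φ ψ =>
    ⟨⟨-(φ.rot * ψ.rot) * ((1 - conj ((ψ.rot • ψ.pt : 𝔻) : ℂ) * φ.pt)
        / (1 - conj (φ.pt : ℂ) * (ψ.rot • ψ.pt : 𝔻))), by
      have hd := one_sub_conj_mul_ne_zero φ.pt (ψ.rot • ψ.pt : 𝔻).norm_lt_one.le
      refine mem_sphere_zero_iff_norm.mpr ?_
      rw [norm_mul, norm_neg, norm_mul, Circle.norm_coe,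
        Circle.norm_coe, norm_div, one_mul, one_mul, div_eq_one_iff_eq (norm_ne_zero_iff.mpr hd),
        ← conj_eq, RCLike.norm_conj]⟩,
     UnitDisc.mk (ψ⁻¹.toFun φ.pt) (ψ⁻¹.norm_toFun_lt_one φ.pt.norm_lt_one)⟩⟩

theorem toFun_mul (φ ψ : DiscAut) {z : ℂ} (hz : ‖z‖ ≤ 1) :
    (φ * ψ).toFun z = φ.toFun (ψ.toFun z) := by
  have hw : ‖ψ.toFun z‖ ≤ 1 := by
    rcases hz.lt_or_eq with h | h
    · exact (ψ.norm_toFun_lt_one h).le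
    · exact (ψ.norm_toFun_eq_one h).le
  have hd := one_sub_conj_mul_ne_zero ψ.pt hz
  have hd1 := one_sub_conj_mul_ne_zero φ.pt hw
  have hd2 := one_sub_conj_mul_ne_zero (φ * ψ).pt hz
  have hF := one_sub_conj_mul_ne_zero φ.pt (ψ.rot • ψ.pt : 𝔻).norm_lt_one.le
  have hE := one_sub_conj_mul_ne_zero (ψ.rot • ψ.pt : 𝔻) φ.pt.norm_lt_one.le
  have hc : conj (ψ.rot : ℂ) * ψ.rot = 1 := by
    rw [mul_comm, mul_conj, Circle.normSq_coe, ofReal_one]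
  have hFE := conj_eq φ ψ
  have hrot : ((φ * ψ).rot : ℂ) = -(φ.rot * ψ.rot) *
      ((1 - conj ((ψ.rot • ψ.pt : 𝔻) : ℂ) * φ.pt)
        / (1 - conj (φ.pt : ℂ) * (ψ.rot • ψ.pt : 𝔻))) := rfl
  have hpt : ((φ * ψ).pt : ℂ) = conj (ψ.rot : ℂ) * ((ψ.rot • ψ.pt : 𝔻) - φ.pt)
      / (1 - conj ((ψ.rot • ψ.pt : 𝔻) : ℂ) * φ.pt) := by
    rw [← Circle.coe_inv_eq_conj]; rfl
  have hptc : conj ((φ * ψ).pt : ℂ) = ψ.rot * (conj ((ψ.rot • ψ.pt : 𝔻) : ℂ) - conj (φ.pt : ℂ))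
      / (1 - conj (φ.pt : ℂ) * (ψ.rot • ψ.pt : 𝔻)) := by
    rw [hpt, map_div₀, hFE, map_mul, map_sub, conj_conj]
  rw [hptc] at hd2
  rw [toFun, toFun, hrot, hptc, hpt]
  rw [toFun] at hd1 ⊢
  rw [UnitDisc.coe_circle_smul] at *
  simp only [map_mul] at *
  generalize (φ.rot : ℂ) = l at *
  generalize (φ.pt : ℂ) = a at *
  generalize conj a = a' at *
  generalize (ψ.pt : ℂ) = b at *
  generalize conj b = b' at *
  generalize (ψ.rot : ℂ) = m at *
  generalize conj m = m' at *
  have hL1 : -(l * m) * ((1 - m' * b' * a) / (1 - a' * (m * b))) *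
      (m' * (m * b - a) / (1 - m' * b' * a) - z)
      = l * (a * (1 - b' * z) - m * (b - z)) / (1 - a' * (m * b)) := by
    have hF' := hF
    generalize 1 - a' * (m * b) = F at hF'
    rw [eq_div_iff hF']
    have : -(l * m) * ((1 - m' * b' * a) / F) *
      (m' * (m * b - a) / (1 - m' * b' * a) - z) * F
      = -(l * m) * (m' * (m * b - a) - z * (1 - m' * b' * a)) := by
      field_simp
    rw [this]
    linear_combination (-(l * (m * b - a)) - l * z * b' * a) * hc
  have hL2 : 1 - m * (m' * b' - a') / (1 - a' * (m * b)) * z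
      = (1 - b' * z - a' * (m * (b - z))) / (1 - a' * (m * b)) := by
    rw [eq_div_iff hF, sub_mul, mul_right_comm, div_mul_cancel₀ _ hF]
    linear_combination (-(b' * z)) * hc
  have hR1 : l * (a - m * (b - z) / (1 - b' * z))
      = l * (a * (1 - b' * z) - m * (b - z)) / (1 - b' * z) := by
    rw [eq_div_iff hd, mul_assoc, sub_mul, div_mul_cancel₀ _ hd]
  have hR2 : 1 - a' * (m * (b - z) / (1 - b' * z))
      = (1 - b' * z - a' * (m * (b - z))) / (1 - b' * z) := by
    rw [eq_div_iff hd, sub_mul, mul_assoc a', div_mul_cancel₀ _ hd, one_mul]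
  rw [hL1, hL2, hR1, hR2, div_div_div_cancel_right₀ hF, div_div_div_cancel_right₀ hd]

instance : Group DiscAut :=
  Group.ofLeftAxioms
    (fun φ ψ χ => ext_toFun fun z hz => by
      rw [toFun_mul _ _ hz.le, toFun_mul _ _ hz.le, toFun_mul _ _ hz.le,
        toFun_mul _ _ (χ.norm_toFun_lt_one hz).le])
    (fun φ => ext_toFun fun z hz => by rw [toFun_mul _ _ hz.le, toFun_one])
    (fun φ => ext_toFun fun z hz => by rw [toFun_mul _ _ hz.le, toFun_inv _ hz.le, toFun_one])

/-- The usual topology on the automorphism group, in which it is homeomorphic to `𝕋 × 𝔻`. -/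
instance : TopologicalSpace DiscAut :=
  TopologicalSpace.induced (fun φ => (φ.rot, φ.pt)) inferInstance

/-- The action on the open disc. -/
instance : MulAction DiscAut 𝔻 where
  smul φ z := UnitDisc.mk (φ.toFun z) (φ.norm_toFun_lt_one z.norm_lt_one)
  one_smul z := UnitDisc.coe_injective (toFun_one z)
  mul_smul φ ψ z := UnitDisc.coe_injective (toFun_mul φ ψ z.norm_lt_one.le)

/-- The action on the boundary circle. -/
instance : MulAction DiscAut Circle where
  smul φ ζ := ⟨φ.toFun ζ, mem_sphere_zero_iff_norm.mpr (φ.norm_toFun_eq_one ζ.norm_coe)⟩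
  one_smul ζ := Subtype.ext (toFun_one ζ)
  mul_smul φ ψ ζ := Subtype.ext (toFun_mul φ ψ ζ.norm_coe.le)

end DiscAut

/-! ### The circle, Hardy spaces and composition -/

instance : MeasurableSpace Circle := borel Circle

instance : BorelSpace Circle := ⟨rfl⟩

/-- Normalized Lebesgue (arc length) measure `m` on the circle. -/
def circleMeasure : Measure Circle :=
  Measure.map (AddCircle.toCircle : AddCircle (1 : ℝ) → Circle) AddCircle.haarAddCircle

/-- `f ∈ H^p`: `f` is an `L^p` function on the circle whose Fourier coefficients of negative
index `-(n+1)` all vanish. Functions are identified when they agree almost everywhere. -/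
def MemHardy (p : ℝ≥0∞) (f : Circle → ℂ) : Prop :=
  MemLp f p circleMeasure ∧ ∀ n : ℕ, ∫ ζ, f ζ * (ζ : ℂ) ^ (n + 1) ∂circleMeasure = 0

/-- The holomorphic extension to the disc of a function in a Hardy space, given by the Cauchy
integral `(1 / 2πi) ∮ f(ζ) / (ζ - z) dζ`. -/
def discExt (f : Circle → ℂ) (z : 𝔻) : ℂ :=
  ∫ ζ, f ζ * (ζ / (ζ - z)) ∂circleMeasure

/-- `f ∈ H^p_σ`: `f ∈ H^p` and `f ∘ γ = σ(γ) f` almost everywhere, for every `γ ∈ Γ`. -/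
def MemCharHardy {Γ : Subgroup DiscAut} (p : ℝ≥0∞) (σ : Γ →ₜ* Circle) (f : Circle → ℂ) : Prop :=
  MemHardy p f ∧
    ∀ γ : Γ, (fun ζ : Circle => f ((γ : DiscAut) • ζ)) =ᵐ[circleMeasure] fun ζ => σ γ * f ζ

/-! ### Blaschke products, singular inner functions, outer functions -/

/-- The Blaschke factor with zero `a`: it is `z` for `a = 0`, and
`(|a| / a) (a - z) / (1 - conj a z)` otherwise. -/
def blaschkeFactor (a z : 𝔻) : ℂ :=
  open Classical in
  if a = 0 then z else ‖(a : ℂ)‖ / a * ((a - z) / (1 - conj (a : ℂ) * z))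

/-- `B` is (the boundary function of) the Blaschke product in which the point `a` is a zero of
multiplicity `k a`, where `∑ k(a) (1 - |a|) < ∞`. Finite products and the constant `1` are
included. -/
def IsBlaschkeProduct (B : Circle → ℂ) : Prop :=
  MemHardy ∞ B ∧ ∃ k : 𝔻 → ℕ, Summable (fun a : 𝔻 => k a * (1 - ‖(a : ℂ)‖)) ∧
    ∀ z : 𝔻, HasProd (fun a : 𝔻 => blaschkeFactor a z ^ k a) (discExt B z)

/-- A singular inner function: an inner function (a function in `H^∞` of modulus one almost
everywhere on the circle) that has no zeros in the disc. Unimodular constants are included. -/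
def IsSingularInner (s : Circle → ℂ) : Prop :=
  MemHardy ∞ s ∧ (∀ᵐ ζ ∂circleMeasure, ‖s ζ‖ = 1) ∧ ∀ z : 𝔻, discExt s z ≠ 0

/-- The topology on `L^p` in which closures are taken: the norm topology for `p < ∞`, and the
weak-star topology of `L^∞ = (L^1)^*` for `p = ∞`. -/
abbrev lpTopology (p : ℝ≥0∞) [Fact (1 ≤ p)] : TopologicalSpace (Lp ℂ p circleMeasure) :=
  open Classical in
  if p = ∞ then
    TopologicalSpace.induced
      (fun (g : Lp ℂ p circleMeasure) (h : Lp ℂ 1 circleMeasure) => ∫ ζ, g ζ * h ζ ∂circleMeasure)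
      inferInstance
  else inferInstance

/-- `u` is an outer function of `H^p`: `u ∈ H^p`, and the closed linear span of the functions
`z^n u`, `n ≥ 0`, is all of `H^p`. -/
def IsOuter (p : ℝ≥0∞) [Fact (1 ≤ p)] (u : Circle → ℂ) : Prop :=
  MemHardy p u ∧
    closure[lpTopology p] (Submodule.span ℂ {g : Lp ℂ p circleMeasure |
        ∃ n : ℕ, g =ᵐ[circleMeasure] fun ζ => (ζ : ℂ) ^ n * u ζ} : Set (Lp ℂ p circleMeasure)) =
      {g : Lp ℂ p circleMeasure | MemHardy p g}

end CharAut

end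

noncomputable section

namespace CharAut

/-! ### Fourier analysis on the circle -/

/-! Fix `γ` in the group and put `Φ = B s`, which is unimodular a.e. From `(Φ∘γ)(u∘γ) = σ(γ) Φ u`
one gets `conj(Φ∘γ) Φ u = conj(σ(γ)) (u∘γ)`, an `H^1` function. Since `1` is a limit of combinations
of the `z^n u`, it follows that `conj(Φ∘γ) Φ` is in `H^∞` (`memHardy_conj_mul`). The same argument
for `γ⁻¹`, composed with `γ`, puts its conjugate in `H^∞`. A unimodular function with both
properties is constant (`exists_ae_eq_const`), so `Φ∘γ = e Φ`.

To separate `B` from `s`, pass to the disc: `s` has no zeros there, so `γ` preserves the zeros of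
`B` with multiplicity (`multiplicity_smul_eq`). The factor at `γa` composed with `γ` is a rotation
of the factor at `a`. Hence `B∘γ / B` is a product of constants, itself a unimodular constant
(`exists_eq_mul_of_multiplicity`). Dividing by `B` and then by `Bs` handles `s` and `u`; this needs
`|B| = 1` a.e. (`IsBlaschkeProduct.norm_ae_eq_one`). Evaluating extensions at a point where they do
not vanish shows that the constants form continuous characters (`exists_character`).

The Hardy space facts are obtained without holomorphy: Parseval, together with multiplication and
division by Moebius factors, gives uniqueness, multiplicativity and invariance of the extension.
Orders of zeros are read from growth rates. -/

theorem measurableEmbedding_toCircle :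
    MeasurableEmbedding (AddCircle.toCircle : AddCircle (1 : ℝ) → Circle) := by
  have h := (AddCircle.homeomorphCircle (T := 1) one_ne_zero).measurableEmbedding
  have h2 : ⇑(AddCircle.homeomorphCircle (T := 1) one_ne_zero) = AddCircle.toCircle := by
    funext x; exact AddCircle.homeomorphCircle_apply one_ne_zero x
  rwa [h2] at h

instance : IsProbabilityMeasure circleMeasure :=
  Measure.isProbabilityMeasure_map measurableEmbedding_toCircle.measurable.aemeasurable

theorem integral_circleMeasure (f : Circle → ℂ) :
    ∫ ζ, f ζ ∂circleMeasure =
      ∫ t : AddCircle (1 : ℝ), f (AddCircle.toCircle t) ∂AddCircle.haarAddCircle :=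
  measurableEmbedding_toCircle.integral_map f

theorem fourier_eq_zpow (n : ℤ) (t : AddCircle (1 : ℝ)) :
    fourier n t = (AddCircle.toCircle t : ℂ) ^ n := by
  rw [fourier_apply, AddCircle.toCircle_zsmul, Circle.coe_zpow]

theorem integral_mul_zpow_eq_fourierCoeff (f : Circle → ℂ) (n : ℤ) :
    ∫ ζ, f ζ * (ζ : ℂ) ^ n ∂circleMeasure =
      fourierCoeff (fun t : AddCircle (1 : ℝ) => f (AddCircle.toCircle t)) (-n) := by
  rw [integral_circleMeasure, fourierCoeff]
  simp only [neg_neg, fourier_eq_zpow, smul_eq_mul, mul_comm]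

theorem integral_zpow {n : ℤ} (hn : n ≠ 0) : ∫ ζ : Circle, (ζ : ℂ) ^ n ∂circleMeasure = 0 := by
  have h := congrFun (fourierCoeff_fourier (T := 1) n) 0
  rw [Pi.single_eq_of_ne hn.symm] at h
  rw [← h, integral_circleMeasure, fourierCoeff]
  refine integral_congr_ae (ae_of_all _ fun t => ?_)
  simp only [neg_zero, fourier_zero, one_smul, fourier_eq_zpow]

theorem continuous_circle_coe : Continuous fun ζ : Circle => (ζ : ℂ) := continuous_subtype_val

theorem continuous_coe_zpow (n : ℤ) : Continuous fun ζ : Circle => (ζ : ℂ) ^ n := by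
  simp only [← Circle.coe_zpow]
  exact continuous_circle_coe.comp (continuous_zpow n)

theorem conj_coe (ζ : Circle) : conj (ζ : ℂ) = (ζ : ℂ)⁻¹ := by
  rw [← Circle.coe_inv_eq_conj, Circle.coe_inv]

theorem memLp_toCircle {f : Circle → ℂ} {p : ℝ≥0∞} (hf : MemLp f p circleMeasure) :
    MemLp (fun t : AddCircle (1 : ℝ) => f (AddCircle.toCircle t)) p AddCircle.haarAddCircle :=
  measurableEmbedding_toCircle.memLp_map_measure_iff.mp hf

theorem memLp_conj {f : Circle → ℂ} {p : ℝ≥0∞} (hf : MemLp f p circleMeasure) :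
    MemLp (fun ζ => conj (f ζ)) p circleMeasure := hf.star

/-- Two square integrable functions whose Fourier series have no frequencies in common
(up to sign) have a product of mean zero. -/
theorem integral_mul_eq_zero {f h : Circle → ℂ} (hf : MemLp f 2 circleMeasure)
    (hh : MemLp h 2 circleMeasure)
    (H : ∀ i : ℤ, ∫ ζ, h ζ * (ζ : ℂ) ^ i ∂circleMeasure = 0 ∨
      ∫ ζ, f ζ * (ζ : ℂ) ^ (-i) ∂circleMeasure = 0) :
    ∫ ζ, h ζ * f ζ ∂circleMeasure = 0 := by
  set y := (memLp_toCircle hf).toLp with hy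
  set x := (memLp_toCircle (memLp_conj hh)).toLp with hx
  have hyc := (memLp_toCircle hf).coeFn_toLp
  have hxc := (memLp_toCircle (memLp_conj hh)).coeFn_toLp
  -- Parseval for `conj h` and `f`. The hypothesis at `i` says that the `i`-th coefficient of one of
  -- the two is zero.
  have key := (fourierBasis (T := 1)).hasSum_inner_mul_inner x y
  have h0 : ∀ i, inner ℂ x (fourierBasis (T := 1) i) * inner ℂ (fourierBasis (T := 1) i) y = 0 := by
    intro i
    rcases H i with h1 | h1
    · have : inner ℂ (fourierBasis (T := 1) i) x = 0 := by
        rw [← HilbertBasis.repr_apply_apply, fourierBasis_repr, fourierCoeff_congr_ae hxc,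
          ← neg_neg i, ← integral_mul_zpow_eq_fourierCoeff fun ζ => conj (h ζ)]
        rw [← map_zero conj, ← h1, ← integral_conj]
        congr 1; funext ζ
        rw [map_mul, map_zpow₀, conj_coe, inv_zpow']
      rw [← inner_conj_symm, this, map_zero, zero_mul]
    · have : inner ℂ (fourierBasis (T := 1) i) y = 0 := by
        rw [← HilbertBasis.repr_apply_apply, fourierBasis_repr, fourierCoeff_congr_ae hyc,
          ← neg_neg i, ← integral_mul_zpow_eq_fourierCoeff, h1]
      rw [this, mul_zero]
  simp only [h0] at key
  have h2 := key.unique hasSum_zero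
  rw [L2.inner_def] at h2
  rw [integral_circleMeasure, ← h2]
  refine integral_congr_ae ?_
  filter_upwards [hyc, hxc] with t h3 h4
  rw [RCLike.inner_apply, h3, h4, conj_conj, mul_comm]

theorem ae_eq_zero_of_integral_normSq {f : Circle → ℂ} (hf : MemLp f 2 circleMeasure)
    (h : ∫ ζ, conj (f ζ) * f ζ ∂circleMeasure = 0) : f =ᵐ[circleMeasure] 0 := by
  have h1 : ∫ ζ, ‖f ζ‖ ^ 2 ∂circleMeasure = 0 := by
    have : ∫ ζ, conj (f ζ) * f ζ ∂circleMeasure = ((∫ ζ, ‖f ζ‖ ^ 2 ∂circleMeasure : ℝ) : ℂ) := by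
      rw [← integral_complex_ofReal]
      congr 1; funext ζ
      rw [conj_mul']; push_cast; rfl
    rw [this] at h
    exact_mod_cast h
  rw [integral_eq_zero_iff_of_nonneg (fun _ => by positivity) hf.integrable_norm_pow'] at h1
  filter_upwards [h1] with ζ h2
  simpa using h2

/-- A square integrable function on the circle is determined by its Fourier coefficients. -/
theorem ae_eq_zero_of_integral_zpow {f : Circle → ℂ} (hf : MemLp f 2 circleMeasure)
    (h : ∀ i : ℤ, ∫ ζ, f ζ * (ζ : ℂ) ^ i ∂circleMeasure = 0) : f =ᵐ[circleMeasure] 0 :=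
  ae_eq_zero_of_integral_normSq hf
    (integral_mul_eq_zero hf (memLp_conj hf) fun i => Or.inr (h (-i)))

/-- A finite measure on the circle is determined by its Fourier coefficients. -/
theorem measure_ext_of_integral_zpow {μ ν : Measure Circle} [IsFiniteMeasure μ] [IsFiniteMeasure ν]
    (h : ∀ n : ℤ, ∫ ζ, (ζ : ℂ) ^ n ∂μ = ∫ ζ, (ζ : ℂ) ^ n ∂ν) : μ = ν := by
  set e := AddCircle.homeomorphCircle (T := 1) one_ne_zero with he
  have hcont : ∀ ρ : Measure Circle, ∀ [IsFiniteMeasure ρ],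
      Continuous fun g : C(AddCircle (1 : ℝ), ℂ) => ∫ ζ, g (e.symm ζ) ∂ρ := by
    intro ρ _
    refine (LipschitzWith.of_dist_le_mul (K := ⟨ρ.real Set.univ, by positivity⟩)
      fun g₁ g₂ => ?_).continuous
    have hi : ∀ g : C(AddCircle (1 : ℝ), ℂ), Integrable (fun ζ => g (e.symm ζ)) ρ := fun g =>
      Integrable.of_bound (C := ‖g‖)
        (g.continuous.comp e.symm.continuous).measurable.aestronglyMeasurable
        (ae_of_all _ fun _ => g.norm_coe_le_norm _)
    rw [dist_eq_norm, ← integral_sub (hi _) (hi _)]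
    refine (norm_integral_le_of_norm_le_const (C := dist g₁ g₂) (ae_of_all _ fun ζ => ?_)).trans ?_
    · rw [← dist_eq_norm]; exact ContinuousMap.dist_apply_le_dist _
    · rw [mul_comm]; rfl
  -- Equality of the integrals is a closed linear condition on `g`. It holds for the characters,
  -- whose span is uniformly dense.
  have heq : ∀ g : C(AddCircle (1 : ℝ), ℂ), ∫ ζ, g (e.symm ζ) ∂μ = ∫ ζ, g (e.symm ζ) ∂ν := by
    have hcl : IsClosed {g : C(AddCircle (1 : ℝ), ℂ) |
        ∫ ζ, g (e.symm ζ) ∂μ = ∫ ζ, g (e.symm ζ) ∂ν} := isClosed_eq (hcont μ) (hcont ν)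
    intro g
    have hg : g ∈ closure (Submodule.span ℂ (Set.range (fourier (T := 1))) : Set _) := by
      have := span_fourier_closure_eq_top (T := 1)
      have h2 : g ∈ (Submodule.span ℂ (Set.range (fourier (T := 1)))).topologicalClosure := by
        rw [this]; trivial
      exact h2
    refine closure_minimal ?_ hcl hg
    intro g hg
    have hi : ∀ ρ : Measure Circle, ∀ [IsFiniteMeasure ρ], ∀ g : C(AddCircle (1 : ℝ), ℂ),
      Integrable (fun ζ => g (e.symm ζ)) ρ := fun ρ _ g =>
      Integrable.of_bound (C := ‖g‖)
        (g.continuous.comp e.symm.continuous).measurable.aestronglyMeasurable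
        (ae_of_all _ fun _ => g.norm_coe_le_norm _)
    induction hg using Submodule.span_induction with
    | mem g hg =>
      obtain ⟨n, rfl⟩ := hg
      have : ∀ ζ, fourier n (e.symm ζ) = (ζ : ℂ) ^ n := fun ζ => by
        rw [fourier_eq_zpow, ← AddCircle.homeomorphCircle_apply one_ne_zero,
          e.apply_symm_apply]
      simp only [Set.mem_ofPred_eq, this]
      exact h n
    | zero => simp
    | add g₁ g₂ _ _ h₁ h₂ =>
      simp only [Set.mem_ofPred_eq, ContinuousMap.add_apply] at *
      rw [integral_add (hi _ _) (hi _ _), integral_add (hi _ _) (hi _ _), h₁, h₂]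
    | smul c g _ h₁ =>
      simp only [Set.mem_ofPred_eq, ContinuousMap.smul_apply] at *
      rw [integral_smul, integral_smul, h₁]
  refine ext_of_forall_integral_eq_of_IsFiniteMeasure fun f => ?_
  have h1 := heq ⟨fun t => (f (e t) : ℂ), by fun_prop⟩
  simp only [ContinuousMap.coe_mk, e.apply_symm_apply] at h1
  rw [integral_complex_ofReal, integral_complex_ofReal] at h1
  exact_mod_cast h1

/-! ### Elementary operations on Hardy spaces -/

theorem memLp_of_bound {g : Circle → ℂ} (hg : AEStronglyMeasurable g circleMeasure) {C : ℝ}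
    (hC : ∀ᵐ ζ ∂circleMeasure, ‖g ζ‖ ≤ C) (p : ℝ≥0∞) : MemLp g p circleMeasure :=
  MemLp.of_bound hg C hC

theorem memLp_mul_of_bound {f g : Circle → ℂ} {p : ℝ≥0∞} (hf : MemLp f p circleMeasure)
    (hg : AEStronglyMeasurable g circleMeasure) {C : ℝ}
    (hC : ∀ᵐ ζ ∂circleMeasure, ‖g ζ‖ ≤ C) : MemLp (fun ζ => f ζ * g ζ) p circleMeasure := by
  refine hf.of_le_mul (c := C) (hf.1.mul hg) ?_
  filter_upwards [hC] with ζ h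
  rw [norm_mul, mul_comm]
  gcongr

theorem continuous_aestronglyMeasurable {g : Circle → ℂ} (hg : Continuous g) :
    AEStronglyMeasurable g circleMeasure := hg.measurable.aestronglyMeasurable

theorem exists_bound_of_continuous {g : Circle → ℂ} (hg : Continuous g) : ∃ C, ∀ ζ, ‖g ζ‖ ≤ C := by
  obtain ⟨C, hC⟩ := isCompact_univ.exists_bound_of_continuousOn hg.continuousOn
  exact ⟨C, fun ζ => hC ζ trivial⟩

theorem memLp_mul_continuous {f g : Circle → ℂ} {p : ℝ≥0∞} (hf : MemLp f p circleMeasure)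
    (hg : Continuous g) : MemLp (fun ζ => f ζ * g ζ) p circleMeasure := by
  obtain ⟨C, hC⟩ := exists_bound_of_continuous hg
  exact memLp_mul_of_bound hf (continuous_aestronglyMeasurable hg) (ae_of_all _ hC)

theorem integrable_mul_continuous {f g : Circle → ℂ} (hf : Integrable f circleMeasure)
    (hg : Continuous g) : Integrable (fun ζ => f ζ * g ζ) circleMeasure :=
  memLp_one_iff_integrable.mp (memLp_mul_continuous (memLp_one_iff_integrable.mpr hf) hg)

theorem MemHardy.mono {p q : ℝ≥0∞} {f : Circle → ℂ} (hf : MemHardy p f) (h : q ≤ p) :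
    MemHardy q f := ⟨hf.1.mono_exponent h, hf.2⟩

theorem MemHardy.integrable {p : ℝ≥0∞} {f : Circle → ℂ} (hf : MemHardy p f) (hp : 1 ≤ p) :
    Integrable f circleMeasure := hf.1.integrable hp

theorem MemHardy.congr_ae {p : ℝ≥0∞} {f g : Circle → ℂ} (hf : MemHardy p f)
    (h : f =ᵐ[circleMeasure] g) : MemHardy p g := by
  refine ⟨hf.1.ae_eq h, fun n => ?_⟩
  rw [← hf.2 n]
  refine integral_congr_ae ?_
  filter_upwards [h] with ζ hζ
  rw [hζ]

theorem discExt_congr_ae {f g : Circle → ℂ} (h : f =ᵐ[circleMeasure] g) (z : 𝔻) :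
    discExt f z = discExt g z := by
  refine integral_congr_ae ?_
  filter_upwards [h] with ζ hζ
  rw [hζ]

theorem MemHardy.sub {p : ℝ≥0∞} (hp : 1 ≤ p) {f g : Circle → ℂ} (hf : MemHardy p f)
    (hg : MemHardy p g) : MemHardy p fun ζ => f ζ - g ζ := by
  refine ⟨hf.1.sub hg.1, fun n => ?_⟩
  have hc : Continuous fun ζ : Circle => (ζ : ℂ) ^ (n + 1) := continuous_circle_coe.pow _
  simp only [sub_mul]
  rw [integral_sub (integrable_mul_continuous (hf.integrable hp) hc)
    (integrable_mul_continuous (hg.integrable hp) hc), hf.2, hg.2, sub_zero]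

theorem MemHardy.const_mul {p : ℝ≥0∞} {f : Circle → ℂ} (hf : MemHardy p f) (c : ℂ) :
    MemHardy p fun ζ => c * f ζ := by
  refine ⟨hf.1.const_mul c, fun n => ?_⟩
  simp only [mul_assoc]
  rw [integral_const_mul, hf.2, mul_zero]

theorem coe_sub_ne_zero (z : 𝔻) (ζ : Circle) : (ζ : ℂ) - z ≠ 0 := by
  intro h
  have := z.norm_ne_one
  rw [← sub_eq_zero.mp h] at this
  exact this ζ.norm_coe

theorem den_ne_zero (a : 𝔻) (ζ : Circle) : 1 - conj (a : ℂ) * ζ ≠ 0 :=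
  one_sub_conj_mul_ne_zero a ζ.norm_coe.le

theorem continuous_den_inv (a : 𝔻) : Continuous fun ζ : Circle => (1 - conj (a : ℂ) * ζ)⁻¹ :=
  Continuous.inv₀ (by have := continuous_circle_coe; fun_prop) (den_ne_zero a)

theorem continuous_kernel (z : 𝔻) : Continuous fun ζ : Circle => (ζ / (ζ - z) : ℂ) :=
  Continuous.div continuous_circle_coe (continuous_circle_coe.sub continuous_const)
    (coe_sub_ne_zero z)

theorem discExt_sub {f g : Circle → ℂ} (hf : Integrable f circleMeasure)
    (hg : Integrable g circleMeasure) (z : 𝔻) :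
    discExt (fun ζ => f ζ - g ζ) z = discExt f z - discExt g z := by
  simp only [discExt, sub_mul]
  exact integral_sub (integrable_mul_continuous hf (continuous_kernel z))
    (integrable_mul_continuous hg (continuous_kernel z))

theorem discExt_const_mul (c : ℂ) (f : Circle → ℂ) (z : 𝔻) :
    discExt (fun ζ => c * f ζ) z = c * discExt f z := by
  simp only [discExt, mul_assoc]
  exact integral_const_mul _ _

/-! ### Multiplication by rational functions -/

theorem MemHardy.mul_coe {p : ℝ≥0∞} {f : Circle → ℂ} (hf : MemHardy p f) :
    MemHardy p fun ζ => f ζ * ζ := by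
  refine ⟨memLp_mul_continuous hf.1 continuous_circle_coe, fun n => ?_⟩
  rw [← hf.2 (n + 1)]
  congr 1; funext ζ; ring

/-- Since `(ζ - z) · ζ/(ζ - z) = ζ`, the two sides differ by the integral of `f ζ`, the first
vanishing coefficient. -/
theorem discExt_mul_coe {f : Circle → ℂ} (hf : MemHardy 1 f) (z : 𝔻) :
    discExt (fun ζ => f ζ * ζ) z = discExt f z * z := by
  have hi := hf.integrable le_rfl
  have hk := continuous_kernel z
  have h0 := hf.2 0
  simp only [zero_add, pow_one] at h0
  rw [← sub_eq_zero, ← h0, discExt, discExt, ← integral_mul_const, ← integral_sub]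
  · congr 1; funext ζ
    have := coe_sub_ne_zero z ζ
    field_simp
  · exact integrable_mul_continuous (integrable_mul_continuous hi continuous_circle_coe) hk
  · exact (integrable_mul_continuous hi hk).mul_const _

theorem MemHardy.mul_pow {p : ℝ≥0∞} {f : Circle → ℂ} (hf : MemHardy p f) (n : ℕ) :
    MemHardy p fun ζ => f ζ * (ζ : ℂ) ^ n := by
  induction n with
  | zero => simpa using hf
  | succ n ih => simpa [pow_succ, mul_assoc] using ih.mul_coe

theorem discExt_mul_pow {f : Circle → ℂ} (hf : MemHardy 1 f) (z : 𝔻) (n : ℕ) :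
    discExt (fun ζ => f ζ * (ζ : ℂ) ^ n) z = discExt f z * (z : ℂ) ^ n := by
  induction n with
  | zero => simp
  | succ n ih =>
    have := discExt_mul_coe (hf.mul_pow n) z
    simp only [pow_succ, ← mul_assoc, this, ih]

/-- The quotient `g` satisfies `g - conj a · ζ g = f`, so each negative coefficient of `g` is `conj
a` times the next. Iterating `k` times bounds it by `|a|^k` times the `L^1` norm of `g`, which tends
to zero. -/
theorem MemHardy.mul_den_inv {p : ℝ≥0∞} (hp : 1 ≤ p) {f : Circle → ℂ} (hf : MemHardy p f) (a : 𝔻) :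
    MemHardy p fun ζ => f ζ * (1 - conj (a : ℂ) * ζ)⁻¹ := by
  refine ⟨memLp_mul_continuous hf.1 (continuous_den_inv a), ?_⟩
  set g : Circle → ℂ := fun ζ => f ζ * (1 - conj (a : ℂ) * ζ)⁻¹ with hg
  have hgi : Integrable g circleMeasure :=
    integrable_mul_continuous (hf.integrable hp) (continuous_den_inv a)
  have hc : ∀ n : ℕ, Continuous fun ζ : Circle => (ζ : ℂ) ^ n := fun n => continuous_circle_coe.pow n
  have hrec : ∀ n : ℕ, ∫ ζ, g ζ * (ζ : ℂ) ^ (n + 1) ∂circleMeasure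
      = conj (a : ℂ) * ∫ ζ, g ζ * (ζ : ℂ) ^ (n + 1 + 1) ∂circleMeasure := by
    intro n
    rw [← sub_eq_zero, ← hf.2 n, ← integral_const_mul, ← integral_sub
      (integrable_mul_continuous hgi (hc _)) ((integrable_mul_continuous hgi (hc _)).const_mul _)]
    congr 1; funext ζ
    have := den_ne_zero a ζ
    simp only [hg]
    field_simp
    ring
  have hiter : ∀ k n : ℕ, ∫ ζ, g ζ * (ζ : ℂ) ^ (n + 1) ∂circleMeasure
      = conj (a : ℂ) ^ k * ∫ ζ, g ζ * (ζ : ℂ) ^ (n + k + 1) ∂circleMeasure := by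
    intro k
    induction k with
    | zero => intro n; simp
    | succ k ih =>
      intro n
      rw [ih n, hrec (n + k), pow_succ, mul_assoc]
      rfl
  intro n
  have hb : ∀ k : ℕ, ‖∫ ζ, g ζ * (ζ : ℂ) ^ (n + 1) ∂circleMeasure‖
      ≤ ‖(a : ℂ)‖ ^ k * ∫ ζ, ‖g ζ‖ ∂circleMeasure := by
    intro k
    rw [hiter k n, norm_mul, norm_pow, RCLike.norm_conj]
    gcongr
    refine (norm_integral_le_integral_norm _).trans_eq ?_
    congr 1; funext ζ
    rw [norm_mul, norm_pow, Circle.norm_coe, one_pow, mul_one]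
  have hlim : Tendsto (fun k : ℕ => ‖(a : ℂ)‖ ^ k * ∫ ζ, ‖g ζ‖ ∂circleMeasure) atTop (𝓝 0) := by
    simpa using (tendsto_pow_atTop_nhds_zero_of_lt_one (norm_nonneg _) a.norm_lt_one).mul_const
      (∫ ζ, ‖g ζ‖ ∂circleMeasure)
  exact norm_le_zero_iff.mp (ge_of_tendsto' hlim hb)

theorem discExt_mul_den_inv {f : Circle → ℂ} (hf : MemHardy 1 f) (a z : 𝔻) :
    discExt (fun ζ => f ζ * (1 - conj (a : ℂ) * ζ)⁻¹) z
      = discExt f z * (1 - conj (a : ℂ) * z)⁻¹ := by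
  have hg := hf.mul_den_inv le_rfl a
  have h1 := discExt_mul_coe hg z
  have h2 := discExt_const_mul (conj (a : ℂ)) (fun ζ => f ζ * (1 - conj (a : ℂ) * ζ)⁻¹ * ζ) z
  have h3 := discExt_sub (hg.integrable le_rfl)
    ((hg.mul_coe.const_mul (conj (a : ℂ))).integrable le_rfl) z
  have h4 : (fun ζ : Circle => f ζ * (1 - conj (a : ℂ) * ζ)⁻¹
      - conj (a : ℂ) * (f ζ * (1 - conj (a : ℂ) * ζ)⁻¹ * ζ)) = f := by
    funext ζ
    have := den_ne_zero a ζ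
    field_simp
  rw [h4, h2, h1] at h3
  rw [h3, eq_mul_inv_iff_mul_eq₀ (one_sub_conj_mul_ne_zero a z.norm_lt_one.le)]
  ring

namespace DiscAut

theorem continuous_toFun_circle (φ : DiscAut) : Continuous fun ζ : Circle => φ.toFun ζ := by
  have := continuous_circle_coe
  exact Continuous.div (by fun_prop) (by fun_prop) (den_ne_zero φ.pt)

theorem norm_toFun_circle (φ : DiscAut) (ζ : Circle) : ‖φ.toFun ζ‖ = 1 :=
  φ.norm_toFun_eq_one ζ.norm_coe

theorem conj_toFun_mul (φ : DiscAut) (ζ : Circle) : conj (φ.toFun ζ) * φ.toFun ζ = 1 := by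
  rw [conj_mul', norm_toFun_circle]; simp

/-- Reduces multiplication by a Moebius map to multiplication by `(1 - conj a · z)⁻¹` and by `z`. -/
theorem mul_toFun_eq (φ : DiscAut) (w z : ℂ) : w * φ.toFun z
    = φ.rot * (φ.pt * (w * (1 - conj (φ.pt : ℂ) * z)⁻¹)
      - w * (1 - conj (φ.pt : ℂ) * z)⁻¹ * z) := by
  rw [toFun, div_eq_mul_inv]; ring

end DiscAut

theorem MemHardy.mul_toFun {p : ℝ≥0∞} (hp : 1 ≤ p) {f : Circle → ℂ} (hf : MemHardy p f)
    (φ : DiscAut) : MemHardy p fun ζ => f ζ * φ.toFun ζ := by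
  simp only [DiscAut.mul_toFun_eq]
  have h := hf.mul_den_inv hp φ.pt
  exact ((h.const_mul _).sub hp h.mul_coe).const_mul _

theorem discExt_mul_toFun {f : Circle → ℂ} (hf : MemHardy 1 f) (φ : DiscAut) (z : 𝔻) :
    discExt (fun ζ => f ζ * φ.toFun ζ) z = discExt f z * φ.toFun z := by
  simp only [DiscAut.mul_toFun_eq]
  have h := hf.mul_den_inv le_rfl φ.pt
  rw [discExt_const_mul, discExt_sub ((h.const_mul _).integrable le_rfl)
    (h.mul_coe.integrable le_rfl), discExt_const_mul, discExt_mul_coe h, discExt_mul_den_inv hf]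

theorem memHardy_one (p : ℝ≥0∞) : MemHardy p fun _ => 1 := by
  refine ⟨memLp_const _, fun n => ?_⟩
  have h := integral_zpow (n := (n + 1 : ℕ)) (by positivity)
  simpa only [one_mul, zpow_natCast] using h

theorem memHardy_const (p : ℝ≥0∞) (c : ℂ) : MemHardy p fun _ => c := by
  simpa using (memHardy_one p).const_mul c

theorem integral_den_inv (a : 𝔻) :
    ∫ ζ : Circle, (1 - conj (a : ℂ) * ζ)⁻¹ ∂circleMeasure = 1 := by
  have h := (memHardy_one 1).mul_den_inv le_rfl a
  have h0 := h.2 0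
  have hi := h.integrable le_rfl
  simp only [zero_add, pow_one, one_mul] at h0 hi
  have h1 : ∫ ζ : Circle, ((1 - conj (a : ℂ) * ζ)⁻¹
      - conj (a : ℂ) * ((1 - conj (a : ℂ) * ζ)⁻¹ * ζ)) ∂circleMeasure = 1 := by
    have : ∀ ζ : Circle, (1 - conj (a : ℂ) * ζ)⁻¹
      - conj (a : ℂ) * ((1 - conj (a : ℂ) * ζ)⁻¹ * ζ) = 1 := fun ζ => by
      have := den_ne_zero a ζ
      field_simp
    simp [this]
  rw [integral_sub hi ((integrable_mul_continuous hi continuous_circle_coe).const_mul _),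
    integral_const_mul, h0] at h1
  simpa using h1

/-- On the circle the Cauchy kernel at `z` is the conjugate of `(1 - conj z · ζ)⁻¹`, which has mean
one. -/
theorem discExt_one (z : 𝔻) : discExt (fun _ => 1) z = 1 := by
  have h := congrArg conj (integral_den_inv z)
  rw [map_one, ← integral_conj] at h
  refine Eq.trans ?_ h
  rw [discExt]
  congr 1; funext ζ
  have h1 := coe_sub_ne_zero z ζ
  have h2 := ζ.coe_ne_zero
  simp only [map_inv₀, map_sub, map_one, map_mul, conj_conj, conj_coe, one_mul]
  field_simp

theorem discExt_const (c : ℂ) (z : 𝔻) : discExt (fun _ => c) z = c := by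
  have := discExt_const_mul c (fun _ => 1) z
  simpa [discExt_one] using this

theorem integral_eq_discExt_zero (f : Circle → ℂ) :
    ∫ ζ, f ζ ∂circleMeasure = discExt f 0 := by
  rw [discExt]
  congr 1; funext ζ
  have := ζ.coe_ne_zero
  simp [this]

/-! ### Division by a Moebius factor -/

/-- With `a = φ.pt`, on the circle `conj φ = 1/φ` has the denominator `a - ζ`. So a negative
coefficient of `f conj φ` is, up to a constant, the extension of `f (ζ^n - conj a · ζ^(n+1))` at
`a`, a multiple of `f(a) = 0`. -/
theorem MemHardy.conj_toFun_mul {p : ℝ≥0∞} (hp : 1 ≤ p) {f : Circle → ℂ} (hf : MemHardy p f)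
    (φ : DiscAut) (h0 : discExt f φ.pt = 0) : MemHardy p fun ζ => f ζ * conj (φ.toFun ζ) := by
  refine ⟨memLp_mul_continuous hf.1 (continuous_conj.comp φ.continuous_toFun_circle), fun n => ?_⟩
  have hf1 := hf.mono hp
  have h1 : discExt (fun ζ => f ζ * (ζ : ℂ) ^ n - conj (φ.pt : ℂ) * (f ζ * (ζ : ℂ) ^ (n + 1)))
      φ.pt = 0 := by
    rw [discExt_sub ((hf1.mul_pow n).integrable le_rfl)
      (((hf1.mul_pow (n + 1)).const_mul _).integrable le_rfl), discExt_const_mul,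
      discExt_mul_pow hf1, discExt_mul_pow hf1, h0]
    simp
  rw [← mul_zero (-(φ.rot : ℂ)⁻¹), ← h1, discExt, ← integral_const_mul]
  congr 1; funext ζ
  have h2 := φ.conj_toFun_mul ζ
  have h3 : φ.toFun ζ ≠ 0 := by
    intro h; rw [h] at h2; simp at h2
  have h4 := den_ne_zero φ.pt ζ
  have h5 := coe_sub_ne_zero φ.pt ζ
  have h6 : (φ.pt : ℂ) - ζ ≠ 0 := by rw [← neg_sub]; exact neg_ne_zero.mpr h5
  have h7 := φ.rot.coe_ne_zero
  change f ζ * conj (φ.toFun ζ) * (ζ : ℂ) ^ (n + 1) = _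
  rw [eq_inv_of_mul_eq_one_left h2, DiscAut.toFun, inv_div]
  rw [← neg_sub (φ.pt : ℂ) ζ]
  field_simp
  ring

theorem discExt_conj_toFun_mul {f : Circle → ℂ} (hf : MemHardy 1 f)
    (φ : DiscAut) (h0 : discExt f φ.pt = 0) (z : 𝔻) :
    discExt (fun ζ => f ζ * conj (φ.toFun ζ)) z * φ.toFun z = discExt f z := by
  rw [← discExt_mul_toFun (hf.conj_toFun_mul le_rfl φ h0)]
  congr 1; funext ζ
  rw [mul_assoc, φ.conj_toFun_mul, mul_one]

/-! ### Continuity and uniqueness of the holomorphic extension -/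

instance firstCountableTopology_unitDisc : FirstCountableTopology 𝔻 :=
  UnitDisc.isEmbedding_coe.isInducing.firstCountableTopology

theorem continuous_discExt {f : Circle → ℂ} (hf : Integrable f circleMeasure) :
    Continuous (discExt f) := by
  refine continuous_iff_continuousAt.mpr fun z₀ => ?_
  obtain ⟨r, hr, hr1⟩ := exists_between z₀.norm_lt_one
  have hev : ∀ᶠ z : 𝔻 in 𝓝 z₀, ‖(z : ℂ)‖ < r :=
    (UnitDisc.continuous_coe.norm.tendsto z₀).eventually (gt_mem_nhds hr)
  refine continuousAt_of_dominated (bound := fun ζ => ‖f ζ‖ * (1 - r)⁻¹) ?_ ?_ ?_ ?_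
  · exact Eventually.of_forall fun z =>
      (integrable_mul_continuous hf (continuous_kernel z)).aestronglyMeasurable
  · filter_upwards [hev] with z hz
    refine ae_of_all _ fun ζ => ?_
    rw [norm_mul, norm_div, Circle.norm_coe, one_div]
    have h1 : 1 - r ≤ ‖(ζ : ℂ) - z‖ := by
      have := norm_sub_norm_le (ζ : ℂ) z
      rw [Circle.norm_coe] at this
      linarith
    have h2 : 0 < 1 - r := by linarith
    gcongr
  · exact hf.norm.mul_const _
  · refine ae_of_all _ fun ζ => ?_
    have := UnitDisc.continuous_coe
    exact (continuousAt_const.mul (continuousAt_const.div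
      (continuousAt_const.sub this.continuousAt) (coe_sub_ne_zero z₀ ζ)))

instance nhdsWithin_ne_neBot (z : 𝔻) : NeBot (𝓝[≠] z) := by
  have h : Set.range ((↑) : 𝔻 → ℂ) = Metric.ball 0 1 := Subtype.range_coe
  have h1 : NeBot (comap ((↑) : 𝔻 → ℂ) (𝓝[≠] (z : ℂ))) := by
    refine NeBot.comap_of_range_mem inferInstance (mem_nhdsWithin_of_mem_nhds ?_)
    rw [h]
    exact Metric.isOpen_ball.mem_nhds (mem_ball_zero_iff.mpr z.norm_lt_one)
  refine h1.mono ?_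
  rw [nhdsWithin, nhdsWithin, comap_inf, ← UnitDisc.isEmbedding_coe.nhds_eq_comap, comap_principal]
  refine inf_le_inf_left _ (principal_mono.mpr fun w hw hwz => hw ?_)
  rw [Set.mem_singleton_iff.mp hwz]
  rfl

/-- The mean is the value at `0`. As that value vanishes, `f/ζ` is again a Hardy function; its
extension vanishes off `0`, hence at `0` by continuity, and its coefficients are those of `f`
shifted by one. -/
theorem integral_zpow_neg_eq_zero_of_discExt_eq_zero {f : Circle → ℂ} (hf : MemHardy 1 f)
    (h : ∀ z : 𝔻, discExt f z = 0) (n : ℕ) :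
    ∫ ζ, f ζ * (ζ : ℂ) ^ (-(n : ℤ)) ∂circleMeasure = 0 := by
  induction n generalizing f with
  | zero => simpa [integral_eq_discExt_zero] using h 0
  | succ n ih =>
    -- The identity has its zero at `0` and boundary values `ζ`, so dividing by it is dividing by
    -- `ζ`.
    set φ : DiscAut := 1 with hφ
    have hpt : φ.pt = 0 := rfl
    have hg := hf.conj_toFun_mul le_rfl φ (h _)
    have hz : ∀ z : 𝔻, discExt (fun ζ => f ζ * conj (φ.toFun ζ)) z * z = 0 := fun z => by
      have := discExt_conj_toFun_mul hf φ (h _) z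
      rwa [h, hφ, DiscAut.toFun_one] at this
    have hcont := continuous_discExt (hg.integrable le_rfl)
    have h0 : ∀ z : 𝔻, discExt (fun ζ => f ζ * conj (φ.toFun ζ)) z = 0 := by
      intro z
      by_cases hz0 : z = 0
      · subst hz0
        refine tendsto_nhds_unique (hcont.continuousAt.tendsto.mono_left
          (nhdsWithin_le_nhds (s := {0}ᶜ))) (tendsto_const_nhds.congr' ?_)
        filter_upwards [self_mem_nhdsWithin] with z hz1
        exact ((mul_eq_zero.mp (hz z)).resolve_right (by simpa using hz1)).symm
      · exact (mul_eq_zero.mp (hz z)).resolve_right (by simpa using hz0)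
    rw [← ih hg h0]
    congr 1; funext ζ
    rw [hφ, DiscAut.toFun_one, conj_coe, mul_assoc]
    congr 1
    rw [← zpow_neg_one, ← zpow_add₀ ζ.coe_ne_zero]
    congr 1; push_cast; ring

/-- A function in a Hardy space is determined by its holomorphic extension. -/
theorem MemHardy.ae_eq_of_discExt_eq {p : ℝ≥0∞} (hp : 2 ≤ p) {f g : Circle → ℂ}
    (hf : MemHardy p f) (hg : MemHardy p g) (h : ∀ z : 𝔻, discExt f z = discExt g z) :
    f =ᵐ[circleMeasure] g := by
  have hp1 : 1 ≤ p := le_trans one_le_two hp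
  have hd := (hf.sub hp1 hg)
  have h0 := ae_eq_zero_of_integral_zpow (hd.1.mono_exponent hp) fun i => ?_
  · filter_upwards [h0] with ζ hζ
    exact sub_eq_zero.mp hζ
  · rcases le_or_gt i 0 with hi | hi
    · obtain ⟨n, rfl⟩ := Int.exists_eq_neg_ofNat hi
      refine integral_zpow_neg_eq_zero_of_discExt_eq_zero (hd.mono hp1) (fun z => ?_) n
      rw [discExt_sub (hf.integrable hp1) (hg.integrable hp1), h, sub_self]
    · obtain ⟨n, rfl⟩ := Int.exists_add_of_le (show (1 : ℤ) ≤ i from hi)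
      rw [← hd.2 n]
      congr 1; funext ζ
      rw [add_comm]
      norm_cast

/-! ### Products of bounded functions -/

/-- Parseval applied to `f` and `g ζ^(n+1)`: for `i ≤ 0` the coefficient of the second vanishes, for
`i > 0` that of the first. -/
theorem MemHardy.mul {f g : Circle → ℂ} (hf : MemHardy ∞ f) (hg : MemHardy ∞ g) :
    MemHardy ∞ fun ζ => f ζ * g ζ := by
  refine ⟨hg.1.mul hf.1, fun n => ?_⟩
  have hgn := (hg.mul_pow (n + 1)).1.mono_exponent (p := 2) le_top
  have := integral_mul_eq_zero hgn (hf.1.mono_exponent (p := 2) le_top) fun i => ?_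
  · simpa [mul_assoc] using this
  · rcases le_or_gt i 0 with hi | hi
    · right
      obtain ⟨k, rfl⟩ := Int.exists_eq_neg_ofNat hi
      rw [← hg.2 (n + k)]
      congr 1; funext ζ
      rw [neg_neg, mul_assoc, zpow_natCast, ← pow_add]
      congr 2; ring
    · left
      obtain ⟨k, rfl⟩ := Int.exists_add_of_le (show (1 : ℤ) ≤ i from hi)
      rw [← hf.2 k]
      congr 1; funext ζ
      rw [add_comm]
      norm_cast

theorem exists_discAut_pt (a : 𝔻) : ∃ φ : DiscAut, φ.pt = a := ⟨⟨1, a⟩, rfl⟩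

theorem DiscAut.toFun_pt (φ : DiscAut) : φ.toFun φ.pt = 0 := by simp [DiscAut.toFun]

/-- Every function in a Hardy space is its value at a point plus a multiple of a Moebius factor. -/
theorem MemHardy.exists_eq_add {p : ℝ≥0∞} (hp : 1 ≤ p) {f : Circle → ℂ} (hf : MemHardy p f)
    (φ : DiscAut) : ∃ g, MemHardy p g ∧ ∀ ζ, f ζ = discExt f φ.pt + g ζ * φ.toFun ζ := by
  have hd := hf.sub hp (memHardy_const p (discExt f φ.pt))
  have h0 : discExt (fun ζ => f ζ - discExt f φ.pt) φ.pt = 0 := by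
    rw [discExt_sub (hf.integrable hp) (integrable_const _), discExt_const, sub_self]
  refine ⟨_, hd.conj_toFun_mul hp φ h0, fun ζ => ?_⟩
  rw [mul_assoc, φ.conj_toFun_mul]; ring

theorem discExt_const_add_mul_toFun {g : Circle → ℂ} (hg : MemHardy 1 g) (c : ℂ) (φ : DiscAut)
    (f : Circle → ℂ) (hf : MemHardy 1 f) :
    discExt (fun ζ => c * f ζ + g ζ * φ.toFun ζ) φ.pt = c * discExt f φ.pt := by
  have h1 : (fun ζ : Circle => c * f ζ + g ζ * φ.toFun ζ)
      = fun ζ : Circle => c * f ζ - (-1) * (g ζ * φ.toFun ζ) := by funext ζ; ring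
  rw [h1, discExt_sub ((hf.const_mul c).integrable le_rfl)
    (((hg.mul_toFun le_rfl φ).const_mul _).integrable le_rfl), discExt_const_mul,
    discExt_const_mul, discExt_mul_toFun hg, φ.toFun_pt]
  ring

/-- Write `f = f(z) + h φ` with `φ` vanishing at `z`. Then `f g = f(z) g + (h g) φ`, and the last
term has extension zero at `z`. -/
theorem discExt_mul {f g : Circle → ℂ} (hf : MemHardy ∞ f) (hg : MemHardy ∞ g) (z : 𝔻) :
    discExt (fun ζ => f ζ * g ζ) z = discExt f z * discExt g z := by
  obtain ⟨φ, rfl⟩ := exists_discAut_pt z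
  obtain ⟨h, hh, hfh⟩ := hf.exists_eq_add le_top φ
  rw [← discExt_const_add_mul_toFun ((hh.mul hg).mono le_top) _ φ g (hg.mono le_top)]
  congr 1; funext ζ
  rw [hfh ζ]; ring

/-! ### Composition with automorphisms -/

namespace DiscAut

theorem coe_smul_circle (φ : DiscAut) (ζ : Circle) : ((φ • ζ : Circle) : ℂ) = φ.toFun ζ := rfl

theorem coe_smul_disc (φ : DiscAut) (z : 𝔻) : ((φ • z : 𝔻) : ℂ) = φ.toFun z := rfl

theorem mul_pt (φ ψ : DiscAut) : (φ * ψ).pt = ψ⁻¹ • φ.pt := rfl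

theorem inv_pt (φ : DiscAut) : (φ⁻¹).pt = φ • (0 : 𝔻) := by
  refine UnitDisc.coe_injective ?_
  rw [coe_smul_disc, toFun]
  change ((φ.rot • φ.pt : 𝔻) : ℂ) = _
  simp

theorem continuous_smul_circle (φ : DiscAut) : Continuous fun ζ : Circle => φ • ζ :=
  Continuous.subtype_mk φ.continuous_toFun_circle _

theorem measurableEmbedding_smul (φ : DiscAut) : MeasurableEmbedding fun ζ : Circle => φ • ζ :=
  φ.continuous_smul_circle.measurableEmbedding (MulAction.injective φ)

end DiscAut

/-- The Poisson kernel of the disc. -/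
def poisson (a : 𝔻) (ζ : Circle) : ℝ := (1 - normSq a) / normSq (1 - conj (a : ℂ) * ζ)

theorem poisson_nonneg (a : 𝔻) (ζ : Circle) : 0 ≤ poisson a ζ :=
  div_nonneg (sub_nonneg.mpr a.normSq_lt_one.le) (normSq_nonneg _)

theorem continuous_poisson (a : 𝔻) : Continuous (poisson a) := by
  have := continuous_circle_coe
  refine Continuous.div continuous_const (continuous_normSq.comp (by fun_prop)) fun ζ => ?_
  exact (normSq_pos.mpr (den_ne_zero a ζ)).ne'

/-- On the circle `conj (1 - conj a · ζ) = (ζ - a)/ζ`. The Poisson kernel is thus an analytic factor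
times the Cauchy kernel at `a`, and Poisson integrals become values of `discExt`. -/
theorem ofReal_poisson (a : 𝔻) (ζ : Circle) : (poisson a ζ : ℂ)
    = (1 - conj (a : ℂ) * a) * (1 - conj (a : ℂ) * ζ)⁻¹ * (ζ / (ζ - a)) := by
  have h1 := coe_sub_ne_zero a ζ
  have h2 := den_ne_zero a ζ
  have h3 := ζ.coe_ne_zero
  have h4 : conj (1 - conj (a : ℂ) * ζ) = (ζ - a) / ζ := by
    simp only [map_sub, map_one, map_mul, conj_conj, conj_coe]
    field_simp
  rw [poisson, ofReal_div, ofReal_sub, ← mul_conj, ← mul_conj, h4, ofReal_one]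
  field_simp

theorem MemHardy.mul_toFun_pow {p : ℝ≥0∞} (hp : 1 ≤ p) {f : Circle → ℂ} (hf : MemHardy p f)
    (φ : DiscAut) (n : ℕ) : MemHardy p fun ζ => f ζ * φ.toFun ζ ^ n := by
  induction n with
  | zero => simpa using hf
  | succ n ih => simpa [pow_succ, mul_assoc] using ih.mul_toFun hp φ

theorem discExt_mul_toFun_pow {f : Circle → ℂ} (hf : MemHardy 1 f) (φ : DiscAut) (z : 𝔻) (n : ℕ) :
    discExt (fun ζ => f ζ * φ.toFun ζ ^ n) z = discExt f z * φ.toFun z ^ n := by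
  induction n with
  | zero => simp
  | succ n ih =>
    have := discExt_mul_toFun (hf.mul_toFun_pow le_rfl φ n) φ z
    simp only [pow_succ, ← mul_assoc, this, ih]

/-- Harmonic measure. -/
def harmonicMeasure (a : 𝔻) : Measure Circle :=
  circleMeasure.withDensity fun ζ => ENNReal.ofReal (poisson a ζ)

theorem integrable_poisson (a : 𝔻) : Integrable (poisson a) circleMeasure :=
  (continuous_poisson a).integrable_of_hasCompactSupport (HasCompactSupport.of_compactSpace _)

instance (a : 𝔻) : IsFiniteMeasure (harmonicMeasure a) :=
  isFiniteMeasure_withDensity_ofReal (integrable_poisson a).2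

theorem integral_harmonicMeasure (a : 𝔻) (f : Circle → ℂ) :
    ∫ ζ, f ζ ∂harmonicMeasure a = ∫ ζ, f ζ * poisson a ζ ∂circleMeasure := by
  rw [harmonicMeasure, integral_withDensity_eq_integral_toReal_smul
    (continuous_poisson a).measurable.ennreal_ofReal (ae_of_all _ fun _ => ENNReal.ofReal_lt_top)]
  congr 1; funext ζ
  rw [ENNReal.toReal_ofReal (poisson_nonneg a ζ), real_smul, mul_comm]

theorem integral_pow_harmonicMeasure (a : 𝔻) (n : ℕ) :
    ∫ ζ : Circle, (ζ : ℂ) ^ n ∂harmonicMeasure a = (a : ℂ) ^ n := by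
  have h1 := (memHardy_one 1).mul_den_inv le_rfl a
  have h2 := discExt_mul_pow h1 a n
  rw [discExt_mul_den_inv (memHardy_one 1), discExt_one, one_mul] at h2
  have h3 := one_sub_conj_mul_ne_zero a a.norm_lt_one.le
  have h4 : (a : ℂ) ^ n = (1 - conj (a : ℂ) * a) * ((1 - conj (a : ℂ) * a)⁻¹ * (a : ℂ) ^ n) := by
    field_simp
  rw [h4, ← h2, discExt, ← integral_const_mul, integral_harmonicMeasure]
  congr 1; funext ζ
  rw [ofReal_poisson]
  ring

theorem integral_pow_map_smul (φ : DiscAut) (n : ℕ) :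
    ∫ ζ : Circle, (ζ : ℂ) ^ n ∂(circleMeasure.map fun ζ => φ • ζ) = ((φ • (0 : 𝔻) : 𝔻) : ℂ) ^ n := by
  rw [φ.measurableEmbedding_smul.integral_map]
  have h := discExt_mul_toFun_pow (memHardy_one 1) φ 0 n
  rw [← integral_eq_discExt_zero, discExt_one] at h
  simpa [DiscAut.coe_smul_circle, DiscAut.coe_smul_disc] using h

/-- An automorphism of the disc maps Lebesgue measure to harmonic measure. -/
theorem map_smul_circleMeasure (φ : DiscAut) :
    circleMeasure.map (fun ζ => φ • ζ) = harmonicMeasure (φ⁻¹).pt := by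
  have : IsFiniteMeasure (circleMeasure.map (fun ζ => φ • ζ)) := by infer_instance
  -- Both moments are `(φ • 0)^n`, because `φ • 0` is the zero of `φ⁻¹`. Negative moments follow by
  -- conjugation.
  have hnat : ∀ n : ℕ, ∫ ζ : Circle, (ζ : ℂ) ^ n ∂(circleMeasure.map fun ζ => φ • ζ)
      = ∫ ζ : Circle, (ζ : ℂ) ^ n ∂harmonicMeasure (φ⁻¹).pt := fun n => by
    rw [integral_pow_map_smul, integral_pow_harmonicMeasure, φ.inv_pt]
  refine measure_ext_of_integral_zpow fun n => ?_
  obtain ⟨n, rfl | rfl⟩ := n.eq_nat_or_neg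
  · simpa using hnat n
  · have h := congrArg conj (hnat n)
    rw [← integral_conj, ← integral_conj] at h
    simpa [conj_coe] using h

theorem integral_comp_smul (φ : DiscAut) (f : Circle → ℂ) :
    ∫ ζ, f (φ • ζ) ∂circleMeasure = ∫ ζ, f ζ * poisson (φ⁻¹).pt ζ ∂circleMeasure := by
  rw [← integral_harmonicMeasure, ← map_smul_circleMeasure, φ.measurableEmbedding_smul.integral_map]

theorem quasiMeasurePreserving_smul (φ : DiscAut) :
    Measure.QuasiMeasurePreserving (fun ζ : Circle => φ • ζ) circleMeasure circleMeasure := by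
  refine ⟨φ.measurableEmbedding_smul.measurable, ?_⟩
  rw [map_smul_circleMeasure]
  exact withDensity_absolutelyContinuous _ _

theorem ae_smul (φ : DiscAut) {P : Circle → Prop} (h : ∀ᵐ ζ ∂circleMeasure, P ζ) :
    ∀ᵐ ζ ∂circleMeasure, P (φ • ζ) := (quasiMeasurePreserving_smul φ).ae h

theorem memLp_comp_smul {p : ℝ≥0∞} {f : Circle → ℂ} (hf : MemLp f p circleMeasure) (φ : DiscAut) :
    MemLp (fun ζ => f (φ • ζ)) p circleMeasure := by
  obtain ⟨C, hC⟩ := isCompact_univ.exists_bound_of_continuousOn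
    (continuous_poisson (φ⁻¹).pt).continuousOn
  refine (φ.measurableEmbedding_smul.memLp_map_measure_iff (g := f)).mp ?_
  rw [map_smul_circleMeasure]
  refine hf.of_measure_le_smul (c := ENNReal.ofReal C) ENNReal.ofReal_ne_top ?_
  rw [harmonicMeasure, ← withDensity_const]
  refine withDensity_mono (ae_of_all _ fun ζ => ENNReal.ofReal_le_ofReal ?_)
  exact (Real.le_norm_self _).trans (hC ζ trivial)

/-- The zero of `φ` at `a` cancels the pole of the Poisson kernel, leaving an analytic function with
a factor `ζ`. -/
theorem toFun_mul_poisson (φ : DiscAut) (ζ : Circle) : φ.toFun ζ * poisson φ.pt ζ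
    = -(φ.rot * (1 - conj (φ.pt : ℂ) * φ.pt)) * ((1 - conj (φ.pt : ℂ) * ζ)⁻¹
      * (1 - conj (φ.pt : ℂ) * ζ)⁻¹ * ζ) := by
  have h1 := coe_sub_ne_zero φ.pt ζ
  have h2 := den_ne_zero φ.pt ζ
  rw [ofReal_poisson, DiscAut.toFun]
  field_simp
  ring

/-- The change of variables turns the coefficient into the integral of `f (φ⁻¹)^(n+1)` against a
Poisson kernel. One of the `n+1` factors absorbs the pole of the kernel; what remains is a Hardy
function times `ζ`, of mean zero. -/
theorem MemHardy.comp_smul {p : ℝ≥0∞} (hp : 1 ≤ p) {f : Circle → ℂ} (hf : MemHardy p f)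
    (φ : DiscAut) : MemHardy p fun ζ => f (φ • ζ) := by
  refine ⟨memLp_comp_smul hf.1 φ, fun n => ?_⟩
  have h1 := integral_comp_smul φ fun ζ => f ζ * ((φ⁻¹).toFun ζ) ^ (n + 1)
  have h2 : ∀ ζ : Circle, (φ⁻¹).toFun ((φ • ζ : Circle) : ℂ) = ζ := fun ζ => by
    rw [← DiscAut.coe_smul_circle, inv_smul_smul]
  simp only [h2] at h1
  rw [h1]
  have h3 := (((hf.mul_toFun_pow hp φ⁻¹ n).mul_den_inv hp (φ⁻¹).pt).mul_den_inv hp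
    (φ⁻¹).pt).const_mul (-((φ⁻¹).rot * (1 - conj ((φ⁻¹).pt : ℂ) * (φ⁻¹).pt)))
  rw [← h3.2 0]
  congr 1; funext ζ
  have h4 := toFun_mul_poisson φ⁻¹ ζ
  rw [pow_succ, ← mul_assoc, mul_assoc, h4]
  ring

/-- Write `f = f(φz) + g ψ` with `ψ` vanishing at `φz`. After composition the second term carries
the factor `ψφ`, which vanishes at `z`. -/
theorem discExt_comp_smul {f : Circle → ℂ} (hf : MemHardy 1 f) (φ : DiscAut) (z : 𝔻) :
    discExt (fun ζ => f (φ • ζ)) z = discExt f (φ • z) := by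
  obtain ⟨ψ, hψ⟩ := exists_discAut_pt (φ • z)
  obtain ⟨g, hg, hfg⟩ := hf.exists_eq_add le_rfl ψ
  have hpt : (ψ * φ).pt = z := by rw [DiscAut.mul_pt, hψ, inv_smul_smul]
  have h := discExt_const_add_mul_toFun (hg.comp_smul le_rfl φ) (discExt f ψ.pt) (ψ * φ) _
    (memHardy_one 1)
  rw [hpt, discExt_one, mul_one, hψ] at h
  rw [← h]
  congr 1; funext ζ
  rw [hfg (φ • ζ), ← DiscAut.coe_smul_circle, ← DiscAut.coe_smul_circle, mul_smul, hψ]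

/-! ### Outer functions and rigidity of the inner factor -/

/-- For `q = ∞` a bounded `k` is an `L^1` test function of the weak-star topology. For `q < ∞` the
functional is Lipschitz, as the `L^1` norm is at most the `L^q` norm on a probability space. -/
theorem continuous_integral_mul {q : ℝ≥0∞} [Fact (1 ≤ q)] {k : Circle → ℂ} {C : ℝ}
    (hk : AEStronglyMeasurable k circleMeasure) (hC : ∀ᵐ ζ ∂circleMeasure, ‖k ζ‖ ≤ C) :
    @Continuous _ _ (lpTopology q) _
      fun g : Lp ℂ q circleMeasure => ∫ ζ, g ζ * k ζ ∂circleMeasure := by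
  by_cases hq : q = ∞
  · have ht : lpTopology q = TopologicalSpace.induced
        (fun (g : Lp ℂ q circleMeasure) (h : Lp ℂ 1 circleMeasure) =>
          ∫ ζ, g ζ * h ζ ∂circleMeasure) inferInstance := if_pos hq
    rw [ht]
    have hk1 := memLp_of_bound hk hC 1
    have h1 : (fun g : Lp ℂ q circleMeasure => ∫ ζ, g ζ * k ζ ∂circleMeasure) =
        (fun F : Lp ℂ 1 circleMeasure → ℂ => F hk1.toLp) ∘
        fun (g : Lp ℂ q circleMeasure) (h : Lp ℂ 1 circleMeasure) =>
          ∫ ζ, g ζ * h ζ ∂circleMeasure := by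
      funext g
      refine integral_congr_ae ?_
      filter_upwards [hk1.coeFn_toLp] with ζ hζ
      rw [hζ]
    rw [h1]
    exact @Continuous.comp _ _ _ (TopologicalSpace.induced _ inferInstance) _ _ _ _
      (continuous_apply hk1.toLp) continuous_induced_dom
  · have ht : lpTopology q =
        (inferInstance : TopologicalSpace (Lp ℂ q circleMeasure)) := if_neg hq
    rw [ht]
    have hi : ∀ g : Lp ℂ q circleMeasure, Integrable (fun ζ => g ζ * k ζ) circleMeasure := fun g =>
      memLp_one_iff_integrable.mp
        (memLp_mul_of_bound ((Lp.memLp g).mono_exponent (Fact.out : 1 ≤ q)) hk hC)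
    have hC0 : 0 ≤ C := by
      obtain ⟨ζ, hζ⟩ := hC.exists
      exact (norm_nonneg _).trans hζ
    refine (LipschitzWith.of_dist_le_mul (K := ⟨C, hC0⟩) fun g₁ g₂ => ?_).continuous
    rw [dist_eq_norm, dist_eq_norm, ← integral_sub (hi _) (hi _)]
    have h1 : ∫ ζ, ‖(g₁ - g₂ : Lp ℂ q circleMeasure) ζ‖ ∂circleMeasure ≤ ‖g₁ - g₂‖ := by
      rw [Lp.norm_def, integral_norm_eq_lintegral_enorm (Lp.aestronglyMeasurable _),
        ← eLpNorm_one_eq_lintegral_enorm]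
      exact ENNReal.toReal_mono (Lp.eLpNorm_ne_top _) (eLpNorm_le_eLpNorm_of_exponent_le
        (Fact.out : 1 ≤ q) (Lp.aestronglyMeasurable _))
    refine le_trans ?_ (mul_le_mul_of_nonneg_left h1 hC0)
    rw [← integral_const_mul]
    refine norm_integral_le_of_norm_le (((Lp.memLp (g₁ - g₂)).integrable
      (Fact.out : 1 ≤ q)).norm.const_mul C) ?_
    filter_upwards [hC, Lp.coeFn_sub g₁ g₂] with ζ h2 h3
    rw [h3, Pi.sub_apply, ← sub_mul, norm_mul, mul_comm]
    gcongr
    exact h2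

/-- A bounded function that annihilates the cyclic subspace of an outer function has mean zero. -/
theorem IsOuter.integral_eq_zero {q : ℝ≥0∞} [Fact (1 ≤ q)] {u k : Circle → ℂ} (hu : IsOuter q u)
    {C : ℝ} (hk : AEStronglyMeasurable k circleMeasure) (hC : ∀ᵐ ζ ∂circleMeasure, ‖k ζ‖ ≤ C)
    (h : ∀ n : ℕ, ∫ ζ : Circle, (ζ : ℂ) ^ n * u ζ * k ζ ∂circleMeasure = 0) :
    ∫ ζ, k ζ ∂circleMeasure = 0 := by
  have hone := memHardy_one q
  have hmem : hone.1.toLp ∈ {g : Lp ℂ q circleMeasure | MemHardy q g} :=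
    hone.congr_ae hone.1.coeFn_toLp.symm
  rw [← hu.2] at hmem
  have hi : ∀ g : Lp ℂ q circleMeasure, Integrable (fun ζ => g ζ * k ζ) circleMeasure := fun g =>
    memLp_one_iff_integrable.mp
      (memLp_mul_of_bound ((Lp.memLp g).mono_exponent (Fact.out : 1 ≤ q)) hk hC)
  have hcl : @IsClosed _ (lpTopology q) {g : Lp ℂ q circleMeasure |
      ∫ ζ, g ζ * k ζ ∂circleMeasure = 0} :=
    @IsClosed.preimage _ _ (lpTopology q) _ _ (continuous_integral_mul hk hC) _ isClosed_singleton
  have h1 := @closure_minimal _ (lpTopology q) _ _ (fun g hg => ?_) hcl _ hmem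
  · rw [← h1]
    refine integral_congr_ae ?_
    filter_upwards [hone.1.coeFn_toLp] with ζ hζ
    rw [hζ, one_mul]
  · change ∫ ζ, g ζ * k ζ ∂circleMeasure = 0
    induction hg using Submodule.span_induction with
    | mem g hg =>
      obtain ⟨n, hn⟩ := hg
      rw [← h n]
      refine integral_congr_ae ?_
      filter_upwards [hn] with ζ hζ
      rw [hζ]
    | zero =>
      rw [← integral_zero Circle ℂ (μ := circleMeasure)]
      refine integral_congr_ae ?_
      filter_upwards [Lp.coeFn_zero ℂ q circleMeasure] with ζ hζ
      rw [hζ, Pi.zero_apply, zero_mul]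
    | add g₁ g₂ _ _ h₁ h₂ =>
      rw [← add_zero (0 : ℂ)]
      nth_rw 1 [← h₁]
      rw [← h₂, ← integral_add (hi _) (hi _)]
      refine integral_congr_ae ?_
      filter_upwards [Lp.coeFn_add g₁ g₂] with ζ hζ
      rw [hζ, Pi.add_apply, add_mul]
    | smul c g _ h₁ =>
      rw [← mul_zero c, ← h₁, ← integral_const_mul]
      refine integral_congr_ae ?_
      filter_upwards [Lp.coeFn_smul c g] with ζ hζ
      rw [hζ, Pi.smul_apply, smul_eq_mul, mul_assoc]

theorem conj_mul_self_of_norm {w : ℂ} (h : ‖w‖ = 1) : conj w * w = 1 := by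
  rw [conj_mul', h]; simp

/-- Intended for `S = Φ∘γ`, `U = u∘γ`. Since `conj S · Φ u = c⁻¹ U`, pairing `z^m u` with `conj S ·
Φ ζ^(n+1)` gives a negative coefficient of `U`, which is zero; an outer `u` lets `z^m u` be replaced
by `1`. -/
theorem memHardy_conj_mul {q : ℝ≥0∞} [Fact (1 ≤ q)] {u U Φ S : Circle → ℂ} (hu : IsOuter q u)
    (hU : MemHardy 1 U) (hΦ : AEStronglyMeasurable Φ circleMeasure)
    (hS : AEStronglyMeasurable S circleMeasure)
    (hΦ1 : ∀ᵐ ζ ∂circleMeasure, ‖Φ ζ‖ = 1) (hS1 : ∀ᵐ ζ ∂circleMeasure, ‖S ζ‖ = 1) {c : ℂ}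
    (hc : c ≠ 0) (h : ∀ᵐ ζ ∂circleMeasure, S ζ * U ζ = c * (Φ ζ * u ζ)) :
    MemHardy ∞ fun ζ => conj (S ζ) * Φ ζ := by
  have hm : AEStronglyMeasurable (fun ζ => conj (S ζ) * Φ ζ) circleMeasure :=
    (continuous_conj.comp_aestronglyMeasurable hS).mul hΦ
  have h1 : ∀ᵐ ζ ∂circleMeasure, ‖conj (S ζ) * Φ ζ‖ = 1 := by
    filter_upwards [hΦ1, hS1] with ζ h2 h3
    rw [norm_mul, RCLike.norm_conj, h2, h3, one_mul]
  refine ⟨memLp_of_bound hm (h1.mono fun ζ h => h.le) _, fun n => ?_⟩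
  refine hu.integral_eq_zero (C := 1) (hm.mul (continuous_aestronglyMeasurable
    (continuous_circle_coe.pow (n + 1)))) ?_ fun m => ?_
  · filter_upwards [h1] with ζ h2
    rw [norm_mul, h2, norm_pow, Circle.norm_coe]
    simp
  · rw [← mul_zero (c⁻¹), ← hU.2 (m + n), ← integral_const_mul]
    refine integral_congr_ae ?_
    filter_upwards [h, hS1] with ζ h2 h3
    have h4 : conj (S ζ) * (c * (Φ ζ * u ζ)) = U ζ := by
      rw [← h2, ← mul_assoc, conj_mul_self_of_norm h3, one_mul]
    rw [← h4]
    field_simp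
    ring

/-- A unimodular function in `H^∞` whose conjugate is in `H^∞` is constant. -/
theorem exists_ae_eq_const {g : Circle → ℂ} (hg : MemHardy ∞ g)
    (hg' : MemHardy ∞ fun ζ => conj (g ζ)) (h1 : ∀ᵐ ζ ∂circleMeasure, ‖g ζ‖ = 1) :
    ∃ c : Circle, ∀ᵐ ζ ∂circleMeasure, g ζ = c := by
  set a := ∫ ζ, g ζ ∂circleMeasure with ha
  have hi := hg.integrable le_top
  -- All Fourier coefficients of `g - a` vanish: on one side by `hg`, on the other by conjugating
  -- `hg'`, and the mean by the choice of `a`.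
  have h0 : ∀ᵐ ζ ∂circleMeasure, g ζ = a := by
    have hd := hg.sub le_top (memHardy_const ∞ a)
    have := ae_eq_zero_of_integral_zpow (hd.1.mono_exponent le_top) fun i => ?_
    · filter_upwards [this] with ζ hζ using sub_eq_zero.mp hζ
    simp only [sub_mul]
    rw [integral_sub (integrable_mul_continuous hi (continuous_coe_zpow i))
      (integrable_mul_continuous (integrable_const a) (continuous_coe_zpow i)), integral_const_mul]
    rcases lt_trichotomy i 0 with hi | rfl | hi
    · rw [integral_zpow hi.ne, mul_zero, sub_zero]
      obtain ⟨k, hk⟩ := Int.exists_add_of_le (show (1 : ℤ) ≤ -i by omega)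
      have hik : i = -((k + 1 : ℕ) : ℤ) := by push_cast; omega
      have h3 := congrArg conj (hg'.2 k)
      rw [← integral_conj, map_zero] at h3
      rw [← h3, hik]
      congr 1; funext ζ
      rw [map_mul, conj_conj, map_pow, conj_coe, zpow_neg, zpow_natCast, inv_pow]
    · simp [ha]
    · rw [integral_zpow hi.ne', mul_zero, sub_zero]
      obtain ⟨k, rfl⟩ := Int.exists_add_of_le (show (1 : ℤ) ≤ i from hi)
      rw [← hg.2 k]
      congr 1; funext ζ
      rw [add_comm]
      norm_cast
  obtain ⟨ζ, h2, h3⟩ := (h0.and h1).exists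
  exact ⟨⟨a, mem_sphere_zero_iff_norm.mpr (h2 ▸ h3)⟩, h0⟩

/-- If the product of an inner and an outer function transforms by constants under an
automorphism and its inverse, then so does the inner function. -/
theorem exists_comp_smul_ae_eq {q : ℝ≥0∞} [Fact (1 ≤ q)] {u Φ : Circle → ℂ} (hu : IsOuter q u)
    (hΦ : AEStronglyMeasurable Φ circleMeasure) (hΦ1 : ∀ᵐ ζ ∂circleMeasure, ‖Φ ζ‖ = 1)
    (φ : DiscAut) {c d : Circle}
    (hc : ∀ᵐ ζ ∂circleMeasure, Φ (φ • ζ) * u (φ • ζ) = c * (Φ ζ * u ζ))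
    (hd : ∀ᵐ ζ ∂circleMeasure, Φ (φ⁻¹ • ζ) * u (φ⁻¹ • ζ) = d * (Φ ζ * u ζ)) :
    ∃ e : Circle, ∀ᵐ ζ ∂circleMeasure, Φ (φ • ζ) = e * Φ ζ := by
  have hu1 := hu.1.mono (Fact.out : 1 ≤ q)
  have hmeas : ∀ ψ : DiscAut, AEStronglyMeasurable (fun ζ => Φ (ψ • ζ)) circleMeasure := fun ψ =>
    hΦ.comp_quasiMeasurePreserving (quasiMeasurePreserving_smul ψ)
  have h1 := memHardy_conj_mul hu (hu1.comp_smul le_rfl φ) hΦ (hmeas φ) hΦ1 (ae_smul φ hΦ1)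
    c.coe_ne_zero hc
  -- The statement for `φ⁻¹`, composed with `φ`, concerns exactly the conjugate of the function in
  -- `h1`.
  have h2 := (memHardy_conj_mul hu (hu1.comp_smul le_rfl φ⁻¹) hΦ (hmeas φ⁻¹) hΦ1
    (ae_smul φ⁻¹ hΦ1) d.coe_ne_zero hd).comp_smul le_top φ
  have h3 : (fun ζ => conj (Φ (φ⁻¹ • φ • ζ)) * Φ (φ • ζ))
      = fun ζ => conj (conj (Φ (φ • ζ)) * Φ ζ) := by
    funext ζ
    rw [inv_smul_smul, map_mul, conj_conj, mul_comm]
  rw [h3] at h2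
  obtain ⟨e, he⟩ := exists_ae_eq_const h1 h2 (by
    filter_upwards [hΦ1, ae_smul φ hΦ1] with ζ h4 h5
    rw [norm_mul, RCLike.norm_conj, h4, h5, one_mul])
  refine ⟨e⁻¹, ?_⟩
  filter_upwards [he, ae_smul φ hΦ1] with ζ h4 h5
  rw [← mul_right_inj' (e.coe_ne_zero), ← mul_assoc, Circle.coe_inv,
    mul_inv_cancel₀ e.coe_ne_zero, one_mul, ← h4, mul_right_comm, conj_mul_self_of_norm h5, one_mul]

/-! ### Blaschke products -/

/-- The Blaschke factor as an automorphism of the disc. -/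
def blaschkeAut (a : 𝔻) : DiscAut :=
  open Classical in
  -- At `a = 0` the rotation `-1` turns `0 - z` into `z`.
  ⟨if h : a = 0 then -1 else ⟨‖(a : ℂ)‖ / a, mem_sphere_zero_iff_norm.mpr (by
    have : ‖(a : ℂ)‖ ≠ 0 := by simpa using h
    rw [norm_div, norm_real, norm_norm, div_self this])⟩, a⟩

theorem blaschkeAut_pt (a : 𝔻) : (blaschkeAut a).pt = a := rfl

theorem blaschkeFactor_eq (a z : 𝔻) : blaschkeFactor a z = (blaschkeAut a).toFun z := by
  rw [blaschkeFactor, DiscAut.toFun, blaschkeAut_pt]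
  split_ifs with h
  · have : (blaschkeAut a).rot = -1 := by simp [blaschkeAut, h]
    rw [this, h]
    simp
  · have : ((blaschkeAut a).rot : ℂ) = ‖(a : ℂ)‖ / a := by simp [blaschkeAut, h]
    rw [this, mul_div_assoc]

theorem blaschkeAut_toFun_zero {a : 𝔻} (h : a ≠ 0) : (blaschkeAut a).toFun 0 = ‖(a : ℂ)‖ := by
  have h1 : (a : ℂ) ≠ 0 := by simpa using h
  have : ((blaschkeAut a).rot : ℂ) = ‖(a : ℂ)‖ / a := by simp [blaschkeAut, h]
  rw [DiscAut.toFun, this, blaschkeAut_pt]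
  field_simp
  simp

namespace DiscAut

/-- With `a = φ.pt`, `1 - |φ(z)|² = (1-|a|²)(1-|z|²)/|1 - conj a · z|²`, and the denominator is at
least `(1-|z|)²`. The `4` bounds `(1+|a|)(1+|z|)`. This carries the Blaschke condition to uniform
estimates on `|z| ≤ r`. -/
theorem one_sub_norm_toFun_le (φ : DiscAut) (z : 𝔻) :
    1 - ‖φ.toFun z‖ ≤ 4 / (1 - ‖(z : ℂ)‖) * (1 - ‖(φ.pt : ℂ)‖) := by
  have hd := one_sub_conj_mul_ne_zero φ.pt z.norm_lt_one.le
  have hk := normSq_den_sub_normSq_num φ.pt z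
  rw [normSq_eq_norm_sq, normSq_eq_norm_sq, normSq_eq_norm_sq, normSq_eq_norm_sq] at hk
  have hn : ‖φ.toFun z‖ = ‖(φ.pt : ℂ) - z‖ / ‖1 - conj (φ.pt : ℂ) * z‖ := by
    rw [toFun, norm_div, norm_mul, Circle.norm_coe, one_mul]
  have hlt := φ.norm_toFun_lt_one z.norm_lt_one
  have h0 := norm_nonneg (φ.toFun z)
  have h1 : 1 - ‖(z : ℂ)‖ ≤ ‖1 - conj (φ.pt : ℂ) * z‖ := by
    have h2 := norm_sub_norm_le (1 : ℂ) (conj (φ.pt : ℂ) * z)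
    rw [norm_one, norm_mul, RCLike.norm_conj] at h2
    nlinarith [norm_nonneg (z : ℂ), φ.pt.norm_lt_one]
  have hz := z.norm_lt_one
  have hp := φ.pt.norm_lt_one
  have hz0 := norm_nonneg (z : ℂ)
  have hp0 := norm_nonneg (φ.pt : ℂ)
  have hD : 0 < ‖1 - conj (φ.pt : ℂ) * z‖ := norm_pos_iff.mpr hd
  set D := ‖1 - conj (φ.pt : ℂ) * z‖
  set N := ‖(φ.pt : ℂ) - z‖
  set x := ‖(z : ℂ)‖
  set y := ‖(φ.pt : ℂ)‖
  have h3 : 1 - ‖φ.toFun z‖ ≤ 1 - ‖φ.toFun z‖ ^ 2 := by nlinarith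
  have h4 : 1 - ‖φ.toFun z‖ ^ 2 = (1 - y ^ 2) * (1 - x ^ 2) / D ^ 2 := by
    rw [hn, ← hk]; field_simp
  refine h3.trans (h4.le.trans ?_)
  have hx1 : 0 < 1 - x := by linarith
  calc (1 - y ^ 2) * (1 - x ^ 2) / D ^ 2 ≤ (1 - y ^ 2) * (1 - x ^ 2) / (1 - x) ^ 2 := by
        have : 0 ≤ (1 - y ^ 2) * (1 - x ^ 2) := mul_nonneg (by nlinarith) (by nlinarith)
        gcongr
    _ = (1 + y) * (1 + x) / (1 - x) * (1 - y) := by field_simp; ring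
    _ ≤ 4 / (1 - x) * (1 - y) := by
        have : 0 ≤ 1 - y := by linarith
        gcongr
        nlinarith

theorem continuous_toFun_disc (φ : DiscAut) : Continuous fun z : 𝔻 => φ.toFun z := by
  have := UnitDisc.continuous_coe
  exact Continuous.div (by fun_prop) (by fun_prop)
    fun z => one_sub_conj_mul_ne_zero φ.pt z.norm_lt_one.le

theorem continuous_smul_disc (φ : DiscAut) : Continuous fun z : 𝔻 => φ • z :=
  UnitDisc.isEmbedding_coe.continuous_iff.mpr φ.continuous_toFun_disc

theorem toFun_ne_zero (φ : DiscAut) {z : 𝔻} (h : z ≠ φ.pt) : φ.toFun z ≠ 0 := by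
  have h1 : (φ.pt : ℂ) - z ≠ 0 := sub_ne_zero.mpr fun h2 => h (UnitDisc.coe_injective h2.symm)
  exact div_ne_zero (mul_ne_zero φ.rot.coe_ne_zero h1)
    (one_sub_conj_mul_ne_zero φ.pt z.norm_lt_one.le)

/-- Two automorphisms with the same zero differ by a rotation. -/
theorem toFun_eq_of_pt_eq {φ ψ : DiscAut} (h : φ.pt = ψ.pt) (z : ℂ) :
    φ.toFun z = (φ.rot / ψ.rot : Circle) * ψ.toFun z := by
  rw [toFun, toFun, h, Circle.coe_div]
  have := ψ.rot.coe_ne_zero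
  field_simp

end DiscAut

/-- Bernoulli's inequality for each power, combined by `(1-x)(1-y) ≥ 0` for factors at most one. -/
theorem one_sub_sum_le_prod_pow {ι : Type*} (s : Finset ι) {x : ι → ℝ} (k : ι → ℕ)
    (h0 : ∀ i, 0 ≤ x i) (h1 : ∀ i, x i ≤ 1) :
    1 - ∑ i ∈ s, k i * (1 - x i) ≤ ∏ i ∈ s, x i ^ k i := by
  classical
  induction s using Finset.induction_on with
  | empty => simp
  | insert a s ha ih =>
    rw [Finset.sum_insert ha, Finset.prod_insert ha]
    have h2 : 1 - k a * (1 - x a) ≤ x a ^ k a := by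
      have := one_add_mul_le_pow (a := x a - 1) (by linarith [h0 a]) (k a)
      rw [add_sub_cancel] at this
      linarith
    have h3 : x a ^ k a ≤ 1 := pow_le_one₀ (h0 a) (h1 a)
    have h4 : ∏ i ∈ s, x i ^ k i ≤ 1 :=
      Finset.prod_le_one (fun i _ => pow_nonneg (h0 i) _) fun i _ => pow_le_one₀ (h0 i) (h1 i)
    nlinarith [mul_nonneg (sub_nonneg.mpr h3) (sub_nonneg.mpr h4)]

theorem exists_finset_norm_prod_ge {k : 𝔻 → ℕ}
    (hk : Summable fun a : 𝔻 => k a * (1 - ‖(a : ℂ)‖)) {r : ℝ} (hr : r < 1) {ε : ℝ} (hε : 0 < ε) :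
    ∃ F : Finset 𝔻, ∀ T : Finset 𝔻, Disjoint T F → ∀ z : 𝔻, ‖(z : ℂ)‖ ≤ r →
      1 - ε ≤ ∏ a ∈ T, ‖(blaschkeAut a).toFun z‖ ^ k a := by
  have hr1 : 0 < 1 - r := by linarith
  obtain ⟨F, hF⟩ := hk.vanishing (Iio_mem_nhds (show (0 : ℝ) < ε * (1 - r) / 4 by positivity))
  refine ⟨F, fun T hT z hz => ?_⟩
  refine le_trans ?_ (one_sub_sum_le_prod_pow T k (fun a => norm_nonneg _) fun a =>
    ((blaschkeAut a).norm_toFun_lt_one z.norm_lt_one).le)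
  have h1 : ∑ a ∈ T, k a * (1 - ‖(blaschkeAut a).toFun z‖)
      ≤ 4 / (1 - r) * ∑ a ∈ T, k a * (1 - ‖(a : ℂ)‖) := by
    rw [Finset.mul_sum]
    refine Finset.sum_le_sum fun a _ => ?_
    rw [mul_left_comm]
    refine mul_le_mul_of_nonneg_left (((blaschkeAut a).one_sub_norm_toFun_le z).trans ?_)
      (Nat.cast_nonneg _)
    rw [blaschkeAut_pt]
    have := a.norm_lt_one
    have : 0 ≤ 1 - ‖(a : ℂ)‖ := by linarith
    gcongr
  have h2 : ∑ a ∈ T, k a * (1 - ‖(a : ℂ)‖) < ε * (1 - r) / 4 := hF T hT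
  have h3 : 4 / (1 - r) * ∑ a ∈ T, k a * (1 - ‖(a : ℂ)‖) ≤ 4 / (1 - r) * (ε * (1 - r) / 4) := by
    gcongr
  have h4 : 4 / (1 - r) * (ε * (1 - r) / 4) = ε := by field_simp
  linarith

section Zeros

variable {k : 𝔻 → ℕ} {b : 𝔻 → ℂ}

theorem norm_le_of_hasProd {a z : 𝔻}
    (hb : HasProd (fun a : 𝔻 => (blaschkeAut a).toFun z ^ k a) (b z)) :
    ‖b z‖ ≤ ‖(blaschkeAut a).toFun z ^ k a‖ := by
  classical
  have hle : ∀ a, ‖(blaschkeAut a).toFun z ^ k a‖ ≤ 1 := fun a => by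
    rw [norm_pow]
    exact pow_le_one₀ (norm_nonneg _) ((blaschkeAut a).norm_toFun_lt_one z.norm_lt_one).le
  refine le_of_tendsto (Tendsto.norm hb) ?_
  filter_upwards [Filter.eventually_ge_atTop {a}] with T hT
  rw [norm_prod, ← Finset.mul_prod_erase T _ (hT (Finset.mem_singleton_self a))]
  exact mul_le_of_le_one_right (norm_nonneg _)
    (Finset.prod_le_one (fun _ _ => norm_nonneg _) fun a _ => hle a)

/-- Outside a large finite set the factors multiply to modulus at least `1/2`, uniformly on `|z| ≤
r`. -/
theorem exists_finset_norm_prod_le (hk : Summable fun a : 𝔻 => k a * (1 - ‖(a : ℂ)‖))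
    (hb : ∀ z : 𝔻, HasProd (fun a : 𝔻 => (blaschkeAut a).toFun z ^ k a) (b z)) {r : ℝ} (hr : r < 1) :
    ∃ F₀ : Finset 𝔻, ∀ F, F₀ ⊆ F → ∀ z : 𝔻, ‖(z : ℂ)‖ ≤ r →
      1 / 2 * ∏ a ∈ F, ‖(blaschkeAut a).toFun z‖ ^ k a ≤ ‖b z‖ := by
  classical
  obtain ⟨F₀, hF₀⟩ := exists_finset_norm_prod_ge hk hr one_half_pos
  refine ⟨F₀, fun F hF z hz => ge_of_tendsto (Tendsto.norm (hb z)) ?_⟩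
  filter_upwards [Filter.eventually_ge_atTop F] with T hT
  simp only [norm_prod, norm_pow]
  rw [← Finset.prod_sdiff hT]
  refine mul_le_mul_of_nonneg_right ?_ (Finset.prod_nonneg fun _ _ => by positivity)
  have := hF₀ (T \ F) (Finset.disjoint_of_subset_right hF Finset.sdiff_disjoint) z hz
  linarith

/-- Near each point of the disc, a Blaschke product is comparable to the corresponding power of
a single factor. -/
theorem isTheta_of_hasProd (hk : Summable fun a : 𝔻 => k a * (1 - ‖(a : ℂ)‖))
    (hb : ∀ z : 𝔻, HasProd (fun a : 𝔻 => (blaschkeAut a).toFun z ^ k a) (b z)) (a : 𝔻) :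
    b =Θ[𝓝 a] fun z : 𝔻 => (blaschkeAut a).toFun z ^ k a := by
  classical
  refine ⟨Asymptotics.IsBigO.of_bound 1 (Eventually.of_forall fun z => ?_), ?_⟩
  · rw [one_mul]; exact norm_le_of_hasProd (hb z)
  obtain ⟨r, hr, hr1⟩ := exists_between a.norm_lt_one
  obtain ⟨F₀, hF₀⟩ := exists_finset_norm_prod_le hk hb hr1
  set h : 𝔻 → ℝ := fun z => ∏ c ∈ F₀.erase a, ‖(blaschkeAut c).toFun z‖ ^ k c with hh
  have hcont : Continuous h := continuous_finsetProd _ fun c _ =>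
    ((blaschkeAut c).continuous_toFun_disc.norm.pow _)
  have hpos : 0 < h a := Finset.prod_pos fun c hc => pow_pos (norm_pos_iff.mpr
    ((blaschkeAut c).toFun_ne_zero (Finset.ne_of_mem_erase hc).symm)) _
  have hev1 : ∀ᶠ z in 𝓝 a, h a / 2 < h z :=
    (hcont.tendsto a).eventually (lt_mem_nhds (by linarith))
  have hev2 : ∀ᶠ z : 𝔻 in 𝓝 a, ‖(z : ℂ)‖ < r :=
    (UnitDisc.continuous_coe.norm.tendsto a).eventually (gt_mem_nhds hr)
  -- One factor `2` comes from the tail of the product, the other from `h z > h a / 2` near `a`; the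
  -- factors in `h` do not vanish at `a`.
  refine Asymptotics.IsBigO.of_bound (4 / h a) ?_
  filter_upwards [hev1, hev2] with z h1 h2
  have h3 := hF₀ (insert a F₀) (Finset.subset_insert _ _) z h2.le
  rw [← Finset.mul_prod_erase _ _ (Finset.mem_insert_self a F₀), Finset.erase_insert_eq_erase] at h3
  change 1 / 2 * (‖(blaschkeAut a).toFun z‖ ^ k a * h z) ≤ ‖b z‖ at h3
  rw [norm_pow, div_mul_eq_mul_div, le_div_iff₀ hpos]
  have h4 : 0 ≤ ‖(blaschkeAut a).toFun z‖ ^ k a := by positivity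
  nlinarith

theorem eq_zero_iff_of_hasProd (hk : Summable fun a : 𝔻 => k a * (1 - ‖(a : ℂ)‖))
    (hb : ∀ z : 𝔻, HasProd (fun a : 𝔻 => (blaschkeAut a).toFun z ^ k a) (b z)) (a : 𝔻) :
    b a = 0 ↔ k a ≠ 0 := by
  have h := isTheta_of_hasProd hk hb a
  constructor
  · intro h0 hka
    have := (h.2.eq_zero_imp).self_of_nhds h0
    simp [hka] at this
  · intro hka
    refine (h.1.eq_zero_imp).self_of_nhds ?_
    have := (blaschkeAut a).toFun_pt
    rw [blaschkeAut_pt] at this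
    rw [this, zero_pow hka]

theorem tendsto_toFun_pt (φ : DiscAut) : Tendsto (fun z : 𝔻 => φ.toFun z) (𝓝 φ.pt) (𝓝 0) := by
  have := φ.continuous_toFun_disc.tendsto φ.pt
  rwa [φ.toFun_pt] at this

theorem frequently_toFun_ne_zero (φ : DiscAut) (m : ℕ) :
    ∃ᶠ z : 𝔻 in 𝓝 φ.pt, ‖φ.toFun z ^ m‖ ≠ 0 := by
  have h : ∀ᶠ z : 𝔻 in 𝓝[≠] φ.pt, ‖φ.toFun z ^ m‖ ≠ 0 := by
    filter_upwards [self_mem_nhdsWithin] with z hz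
    exact norm_ne_zero_iff.mpr (pow_ne_zero _ (φ.toFun_ne_zero hz))
  exact h.frequently.filter_mono nhdsWithin_le_nhds

/-- Near its zero `φ` tends to `0` and is nonzero off that point, so distinct powers have distinct
growth. This lets multiplicities be recovered from `=Θ`. -/
theorem eq_of_isTheta_toFun_pow {φ : DiscAut} {m n : ℕ}
    (h : (fun z : 𝔻 => φ.toFun z ^ m) =Θ[𝓝 φ.pt] fun z : 𝔻 => φ.toFun z ^ n) : m = n := by
  have key : ∀ {m n : ℕ}, m < n → ¬ (fun z : 𝔻 => φ.toFun z ^ m) =O[𝓝 φ.pt]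
      fun z : 𝔻 => φ.toFun z ^ n := fun {m n} hmn hO => by
    have h1 := (Asymptotics.isLittleO_pow_pow (𝕜 := ℂ) hmn).comp_tendsto (tendsto_toFun_pt φ)
    exact Asymptotics.isLittleO_irrefl' (frequently_toFun_ne_zero φ m) (hO.trans_isLittleO h1)
  rcases lt_trichotomy m n with hmn | hmn | hmn
  · exact (key hmn h.1).elim
  · exact hmn
  · exact (key hmn h.2).elim

theorem blaschkeAut_mul_pt (φ : DiscAut) (a : 𝔻) : (blaschkeAut (φ • a) * φ).pt = a := by
  rw [DiscAut.mul_pt, blaschkeAut_pt, inv_smul_smul]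

/-- Both sides, as functions of `z`, are automorphisms with zero `a`, so they differ by a rotation
independent of `z`. -/
theorem exists_toFun_smul_eq (φ : DiscAut) (a : 𝔻) : ∃ d : Circle, ∀ z : 𝔻,
    (blaschkeAut (φ • a)).toFun (φ • z : 𝔻) = d * (blaschkeAut a).toFun z :=
  ⟨_, fun z => by
    rw [DiscAut.coe_smul_disc, ← DiscAut.toFun_mul _ _ z.norm_lt_one.le]
    exact DiscAut.toFun_eq_of_pt_eq (ψ := blaschkeAut a) (blaschkeAut_mul_pt φ a) z⟩

/-- The zeros of a Blaschke product that is invariant up to nonvanishing factors are invariant. -/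
theorem multiplicity_smul_eq (hk : Summable fun a : 𝔻 => k a * (1 - ‖(a : ℂ)‖))
    (hb : ∀ z : 𝔻, HasProd (fun a : 𝔻 => (blaschkeAut a).toFun z ^ k a) (b z)) {s : 𝔻 → ℂ}
    (hs : Continuous s) (hs0 : ∀ z, s z ≠ 0) (φ : DiscAut) {c : ℂ} (hc : c ≠ 0)
    (h : ∀ z, b (φ • z) * s (φ • z) = c * (b z * s z)) (a : 𝔻) : k (φ • a) = k a := by
  -- A continuous nonvanishing function is locally comparable to `1`, so `s` does not affect orders
  -- of vanishing.
  have hT : ∀ t : 𝔻 → ℂ, Continuous t → (∀ z, t z ≠ 0) → t =Θ[𝓝 a] fun _ => (1 : ℂ) := by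
    intro t ht ht0
    exact (((Asymptotics.isEquivalent_const_iff_tendsto (ht0 a)).mpr
      (ht.tendsto a)).isTheta).trans (Asymptotics.isTheta_const_const (ht0 a) one_ne_zero)
  have h1 : (fun z => b (φ • z) * s (φ • z)) =Θ[𝓝 a]
      fun z => (blaschkeAut a).toFun z ^ k (φ • a) * 1 := by
    refine Asymptotics.IsTheta.mul ?_ (hT _ (hs.comp φ.continuous_smul_disc) fun z => hs0 _)
    have h2 := isTheta_of_hasProd hk hb (φ • a)
    have h3 : Tendsto (fun z : 𝔻 => φ • z) (𝓝 a) (𝓝 (φ • a)) := φ.continuous_smul_disc.tendsto a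
    have h4 : (fun z => b (φ • z)) =Θ[𝓝 a]
        fun z : 𝔻 => (blaschkeAut (φ • a)).toFun (φ • z : 𝔻) ^ k (φ • a) :=
      ⟨h2.1.comp_tendsto h3, h2.2.comp_tendsto h3⟩
    refine h4.trans (Asymptotics.IsTheta.of_norm_eventuallyEq_norm (Eventually.of_forall fun z => ?_))
    obtain ⟨d, hd⟩ := exists_toFun_smul_eq φ a
    simp only [hd, norm_pow, norm_mul, Circle.norm_coe, one_mul]
  have h2 : (fun z => c * (b z * s z)) =Θ[𝓝 a] fun z => 1 * ((blaschkeAut a).toFun z ^ k a * 1) :=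
    (Asymptotics.isTheta_const_const hc one_ne_zero).mul
      ((isTheta_of_hasProd hk hb a).mul (hT s hs hs0))
  simp only [h, mul_one] at h1
  simp only [mul_one, one_mul] at h2
  exact eq_of_isTheta_toFun_pow (φ := blaschkeAut a) (h1.symm.trans h2)

/-- A Blaschke product with invariant zeros transforms by a unimodular constant. -/
theorem exists_eq_mul_of_multiplicity (hk : Summable fun a : 𝔻 => k a * (1 - ‖(a : ℂ)‖))
    (hb : ∀ z : 𝔻, HasProd (fun a : 𝔻 => (blaschkeAut a).toFun z ^ k a) (b z)) (φ : DiscAut)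
    (h : ∀ a, k (φ • a) = k a) : ∃ c : Circle, ∀ z, b (φ • z) = c * b z := by
  choose d hd using exists_toFun_smul_eq φ
  have hprod : ∀ z : 𝔻, HasProd (fun a => (d a : ℂ) ^ k a * (blaschkeAut a).toFun z ^ k a)
      (b (φ • z)) := fun z => by
    have h1 := (MulAction.toPerm φ : Equiv.Perm 𝔻).hasProd_iff.mpr (hb (φ • z))
    refine h1.congr_fun fun a => ?_
    change _ = (blaschkeAut (φ • a)).toFun (φ • z : 𝔻) ^ k (φ • a)
    rw [hd, h, mul_pow]
  -- The partial products of the quotient do not involve `z`, so its limit is the same at every `z`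
  -- with `b z ≠ 0`.
  have hquot : ∀ z : 𝔻, b z ≠ 0 → HasProd (fun a => (d a : ℂ) ^ k a) (b (φ • z) / b z) := fun z hz => by
    refine (Tendsto.div (hprod z) (hb z) hz).congr' ?_
    refine Eventually.of_forall fun T => ?_
    have hne : ∏ a ∈ T, (blaschkeAut a).toFun z ^ k a ≠ 0 := by
      refine Finset.prod_ne_zero_iff.mpr fun a _ h0 => hz ?_
      have := norm_le_of_hasProd (a := a) (hb z)
      rw [h0, norm_zero] at this
      exact norm_le_zero_iff.mp this
    rw [Pi.div_apply, Finset.prod_mul_distrib, mul_div_cancel_right₀ _ hne]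
  by_cases hex : ∃ z, b z ≠ 0
  · obtain ⟨z₀, hz₀⟩ := hex
    have hc : ‖b (φ • z₀) / b z₀‖ = 1 := by
      refine tendsto_nhds_unique (Tendsto.norm (hquot z₀ hz₀)) ?_
      simp only [norm_prod, norm_pow, Circle.norm_coe, one_pow, Finset.prod_const_one]
      exact tendsto_const_nhds
    refine ⟨⟨_, mem_sphere_zero_iff_norm.mpr hc⟩, fun z => ?_⟩
    by_cases hz : b z = 0
    · rw [hz, mul_zero]
      rw [eq_zero_iff_of_hasProd hk hb] at hz ⊢
      rwa [h]
    · change _ = b (φ • z₀) / b z₀ * b z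
      rw [(hquot z₀ hz₀).unique (hquot z hz), div_mul_cancel₀ _ hz]
  · push Not at hex
    exact ⟨1, fun z => by simp [hex]⟩

end Zeros

/-! ### Blaschke products are inner -/

/-- The boundary function of a finite Blaschke product. -/
def finiteBlaschke (k : 𝔻 → ℕ) (F : Finset 𝔻) (ζ : Circle) : ℂ :=
  ∏ a ∈ F, (blaschkeAut a).toFun ζ ^ k a

theorem norm_finiteBlaschke (k : 𝔻 → ℕ) (F : Finset 𝔻) (ζ : Circle) :
    ‖finiteBlaschke k F ζ‖ = 1 := by
  simp only [finiteBlaschke, norm_prod, norm_pow, DiscAut.norm_toFun_circle, one_pow,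
    Finset.prod_const_one]

theorem finiteBlaschke_hardy (k : 𝔻 → ℕ) (F : Finset 𝔻) : MemHardy ∞ (finiteBlaschke k F) ∧
    ∀ z : 𝔻, discExt (finiteBlaschke k F) z = ∏ a ∈ F, (blaschkeAut a).toFun z ^ k a := by
  classical
  induction F using Finset.induction_on with
  | empty =>
    have : finiteBlaschke k ∅ = fun _ => 1 := by funext ζ; simp [finiteBlaschke]
    rw [this]
    exact ⟨memHardy_one _, fun z => by rw [discExt_one, Finset.prod_empty]⟩
  | insert a F ha ih =>
    have : finiteBlaschke k (insert a F)
        = fun ζ : Circle => finiteBlaschke k F ζ * (blaschkeAut a).toFun ζ ^ k a := by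
      funext ζ
      rw [finiteBlaschke, Finset.prod_insert ha, mul_comm]
      rfl
    rw [this]
    refine ⟨ih.1.mul_toFun_pow le_top _ _, fun z => ?_⟩
    rw [discExt_mul_toFun_pow (ih.1.mono le_top), ih.2, Finset.prod_insert ha, mul_comm]

theorem norm_toLp_sq {f : Circle → ℂ} (hf : MemLp f 2 circleMeasure) :
    ‖hf.toLp‖ ^ 2 = ∫ ζ, ‖f ζ‖ ^ 2 ∂circleMeasure := by
  have h := inner_self_eq_norm_sq (𝕜 := ℂ) hf.toLp
  rw [← h, L2.inner_def, ← integral_re]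
  · refine integral_congr_ae ?_
    filter_upwards [hf.coeFn_toLp] with ζ hζ
    rw [hζ, inner_self_eq_norm_sq]
  · exact L2.integrable_inner _ _

/-- The difference has modulus `|Q - 1|`, where `Q` is the product over `T \ F`, and `|Q - 1|² = 2 -
2 Re Q`. The mean of `Q` is its value at the origin, which is `∏ |a|^k(a)` because `0 ∈ F` keeps the
factor `z` out of `Q`. -/
theorem integral_norm_finiteBlaschke_sub_sq_le [DecidableEq 𝔻] (k : 𝔻 → ℕ) {F T : Finset 𝔻} (hFT : F ⊆ T)
    (h0 : (0 : 𝔻) ∈ F) :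
    ∫ ζ, ‖finiteBlaschke k T ζ - finiteBlaschke k F ζ‖ ^ 2 ∂circleMeasure
      ≤ 2 * ∑ a ∈ T \ F, k a * (1 - ‖(a : ℂ)‖) := by
  set Q := finiteBlaschke k (T \ F) with hQ
  have hQi : Integrable Q circleMeasure := (finiteBlaschke_hardy k (T \ F)).1.integrable le_top
  have h1 : ∀ ζ, ‖finiteBlaschke k T ζ - finiteBlaschke k F ζ‖ ^ 2 = 2 - 2 * (Q ζ).re := by
    intro ζ
    have h2 : finiteBlaschke k T ζ - finiteBlaschke k F ζ = (Q ζ - 1) * finiteBlaschke k F ζ := by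
      rw [sub_mul, one_mul, hQ, finiteBlaschke, finiteBlaschke, finiteBlaschke,
        Finset.prod_sdiff hFT]
    have h3 : normSq (Q ζ) = 1 := by rw [normSq_eq_norm_sq, norm_finiteBlaschke, one_pow]
    rw [h2, norm_mul, norm_finiteBlaschke, mul_one, ← normSq_eq_norm_sq, normSq_sub, h3]
    simp
    ring
  have h2 : ∫ ζ, Q ζ ∂circleMeasure = (∏ a ∈ T \ F, ‖(a : ℂ)‖ ^ k a : ℝ) := by
    rw [integral_eq_discExt_zero, (finiteBlaschke_hardy k (T \ F)).2, ofReal_prod]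
    refine Finset.prod_congr rfl fun a ha => ?_
    rw [UnitDisc.coe_zero, blaschkeAut_toFun_zero, ofReal_pow]
    rintro rfl
    exact (Finset.mem_sdiff.mp ha).2 h0
  have h3 : ∫ ζ, (Q ζ).re ∂circleMeasure = ∏ a ∈ T \ F, ‖(a : ℂ)‖ ^ k a := by
    have h4 : ∫ ζ, (Q ζ).re ∂circleMeasure = (∫ ζ, Q ζ ∂circleMeasure).re := integral_re hQi
    rw [h4, h2, ofReal_re]
  have h4 : Integrable (fun ζ => (Q ζ).re) circleMeasure := hQi.re
  simp only [h1]
  rw [integral_sub (integrable_const _) (h4.const_mul 2), integral_const_mul, h3]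
  have h5 := one_sub_sum_le_prod_pow (T \ F) (x := fun a : 𝔻 => ‖(a : ℂ)‖) k
    (fun a => norm_nonneg _) fun a => a.norm_lt_one.le
  simp
  linarith

/-- The finite products are Cauchy in `L²`. Their limit `b` lies in `H²` with the same extension as
`B`, so `B = b` a.e. As an `L²` limit of unimodular functions, `b` is unimodular. -/
theorem IsBlaschkeProduct.norm_ae_eq_one {B : Circle → ℂ} (hB : IsBlaschkeProduct B) :
    ∀ᵐ ζ ∂circleMeasure, ‖B ζ‖ = 1 := by
  classical
  obtain ⟨hBH, k, hk, hprod⟩ := hB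
  have h2 : ∀ F, MemLp (finiteBlaschke k F) 2 circleMeasure := fun F =>
    (finiteBlaschke_hardy k F).1.1.mono_exponent le_top
  set x : Finset 𝔻 → Lp ℂ 2 circleMeasure := fun F => (h2 F).toLp with hx
  have hcauchy : CauchySeq x := by
    rw [Metric.cauchySeq_iff']
    intro ε hε
    obtain ⟨F, hF⟩ := hk.vanishing (Iio_mem_nhds (show (0 : ℝ) < ε ^ 2 / 2 by positivity))
    refine ⟨insert 0 F, fun T hT => ?_⟩
    rw [dist_eq_norm]
    refine lt_of_pow_lt_pow_left₀ 2 hε.le ?_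
    simp only [hx]
    rw [← MemLp.toLp_sub, norm_toLp_sq]
    refine (integral_norm_finiteBlaschke_sub_sq_le k hT (Finset.mem_insert_self _ _)).trans_lt ?_
    have h3 : ∑ a ∈ T \ insert 0 F, k a * (1 - ‖(a : ℂ)‖) < ε ^ 2 / 2 :=
      hF _ (Finset.disjoint_of_subset_right (Finset.subset_insert _ _) Finset.sdiff_disjoint)
    linarith
  obtain ⟨b, hb⟩ := cauchySeq_tendsto_of_complete hcauchy
  have htop : lpTopology 2 = (inferInstance : TopologicalSpace (Lp ℂ 2 circleMeasure)) :=
    if_neg ENNReal.ofNat_ne_top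
  have hlim : ∀ g : Circle → ℂ, Continuous g →
      Tendsto (fun F => ∫ ζ, finiteBlaschke k F ζ * g ζ ∂circleMeasure) atTop
        (𝓝 (∫ ζ, b ζ * g ζ ∂circleMeasure)) := by
    intro g hg
    obtain ⟨C, hC⟩ := exists_bound_of_continuous hg
    have hc := continuous_integral_mul (q := 2) (continuous_aestronglyMeasurable hg)
      (ae_of_all _ hC)
    rw [htop] at hc
    refine ((hc.tendsto b).comp hb).congr fun F => ?_
    refine integral_congr_ae ?_
    filter_upwards [(h2 F).coeFn_toLp] with ζ hζ
    rw [hζ]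
  have hbH : MemHardy 2 b := by
    refine ⟨Lp.memLp b, fun n => ?_⟩
    refine tendsto_nhds_unique (hlim _ (continuous_circle_coe.pow (n + 1))) ?_
    refine tendsto_const_nhds.congr fun F => ?_
    exact ((finiteBlaschke_hardy k F).1.2 n).symm
  have hext : ∀ z : 𝔻, discExt B z = discExt b z := by
    intro z
    have h3 := hprod z
    simp only [blaschkeFactor_eq] at h3
    refine tendsto_nhds_unique h3 ((hlim _ (continuous_kernel z)).congr fun F => ?_)
    exact (finiteBlaschke_hardy k F).2 z
  have hBb := (hBH.mono le_top).ae_eq_of_discExt_eq le_rfl hbH hext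
  have hb1 : ∀ᵐ ζ ∂circleMeasure, ‖b ζ‖ = 1 := by
    have hle : ∀ F, ∫ ζ, (1 - ‖b ζ‖) ^ 2 ∂circleMeasure ≤ ‖x F - b‖ ^ 2 := by
      intro F
      have h3 : x F - b = ((h2 F).sub (Lp.memLp b)).toLp := by
        rw [MemLp.toLp_sub (h2 F) (Lp.memLp b), Lp.toLp_coeFn]
      rw [h3, norm_toLp_sq]
      refine integral_mono_of_nonneg (ae_of_all _ fun ζ => sq_nonneg _)
        ((h2 F).sub (Lp.memLp b)).integrable_norm_pow' (ae_of_all _ fun ζ => ?_)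
      refine sq_le_sq' ?_ ?_
      · have := norm_sub_norm_le (b ζ) (finiteBlaschke k F ζ)
        rw [norm_finiteBlaschke, norm_sub_rev] at this
        rw [Pi.sub_apply]
        linarith
      · have := norm_sub_norm_le (finiteBlaschke k F ζ) (b ζ)
        rwa [norm_finiteBlaschke] at this
    have h3 : Tendsto (fun F => ‖x F - b‖ ^ 2) atTop (𝓝 0) := by
      simpa using (tendsto_iff_norm_sub_tendsto_zero.mp hb).pow 2
    have h4 : ∫ ζ, (1 - ‖b ζ‖) ^ 2 ∂circleMeasure = 0 :=
      le_antisymm (ge_of_tendsto' h3 hle) (integral_nonneg fun ζ => sq_nonneg _)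
    have h5 : MemLp (fun ζ => 1 - ‖b ζ‖) 2 circleMeasure := (memLp_const 1).sub (Lp.memLp b).norm
    rw [integral_eq_zero_iff_of_nonneg (fun ζ => sq_nonneg _) h5.integrable_sq] at h4
    filter_upwards [h4] with ζ hζ
    have : 1 - ‖b ζ‖ = 0 := by simpa using hζ
    linarith
  filter_upwards [hBb, hb1] with ζ h3 h4
  rw [h3, h4]

/-- A Blaschke product whose product with a singular inner function transforms by a unimodular
constant under an automorphism transforms itself by such a constant. -/
theorem IsBlaschkeProduct.exists_comp_smul_ae_eq {B s : Circle → ℂ} (hB : IsBlaschkeProduct B)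
    (hs : IsSingularInner s) (φ : DiscAut) {c : Circle}
    (h : ∀ᵐ ζ ∂circleMeasure, B (φ • ζ) * s (φ • ζ) = c * (B ζ * s ζ)) :
    ∃ d : Circle, ∀ᵐ ζ ∂circleMeasure, B (φ • ζ) = d * B ζ := by
  obtain ⟨hBH, k, hk, hprod⟩ := hB
  obtain ⟨hsH, -, hs0⟩ := hs
  simp only [blaschkeFactor_eq] at hprod
  have hdisc : ∀ z : 𝔻, discExt B (φ • z) * discExt s (φ • z) = c * (discExt B z * discExt s z) := by
    intro z
    rw [← discExt_mul hBH hsH, ← discExt_mul hBH hsH, ← discExt_const_mul,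
      ← discExt_comp_smul ((hBH.mul hsH).mono le_top)]
    exact discExt_congr_ae h z
  have hmult := multiplicity_smul_eq hk hprod (continuous_discExt (hsH.integrable le_top)) hs0 φ
    c.coe_ne_zero hdisc
  obtain ⟨d, hd⟩ := exists_eq_mul_of_multiplicity hk hprod φ hmult
  refine ⟨d, (hBH.comp_smul le_top φ).ae_eq_of_discExt_eq le_top (hBH.const_mul d) fun z => ?_⟩
  rw [discExt_comp_smul (hBH.mono le_top), discExt_const_mul, hd]

theorem IsBlaschkeProduct.exists_discExt_ne_zero {B : Circle → ℂ} (hB : IsBlaschkeProduct B) :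
    ∃ z, discExt B z ≠ 0 := by
  by_contra! h
  have h0 := hB.1.ae_eq_of_discExt_eq le_top (memHardy_const ∞ 0) fun z => by
    rw [h, discExt_const]
  obtain ⟨ζ, h1, h2⟩ := (h0.and hB.norm_ae_eq_one).exists
  rw [h1] at h2
  simp at h2

/-! ### Characters -/

theorem DiscAut.continuous_smul_point (z : 𝔻) : Continuous fun φ : DiscAut => φ • z := by
  have h : Continuous fun φ : DiscAut => (φ.rot, φ.pt) := continuous_induced_dom
  have h1 : Continuous fun φ : DiscAut => (φ.rot : ℂ) := continuous_circle_coe.comp h.fst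
  have h2 : Continuous fun φ : DiscAut => (φ.pt : ℂ) := UnitDisc.continuous_coe.comp h.snd
  refine UnitDisc.isEmbedding_coe.continuous_iff.mpr ?_
  exact Continuous.div (h1.mul (h2.sub continuous_const))
    (continuous_const.sub ((continuous_conj.comp h2).mul continuous_const))
    fun φ => one_sub_conj_mul_ne_zero φ.pt z.norm_lt_one.le

/-- A nonzero bounded analytic function that transforms by unimodular constants under a group of
automorphisms transforms by a continuous character. -/
theorem exists_character {Γ : Subgroup DiscAut} {g : Circle → ℂ} (hg : MemHardy ∞ g)
    {z₀ : 𝔻} (hz₀ : discExt g z₀ ≠ 0)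
    (h : ∀ γ : Γ, ∃ c : Circle, ∀ᵐ ζ ∂circleMeasure, g ((γ : DiscAut) • ζ) = c * g ζ) :
    ∃ σ : Γ →ₜ* Circle, MemCharHardy ∞ σ g := by
  choose c hc using h
  have hdisc : ∀ (γ : Γ) (z : 𝔻), discExt g ((γ : DiscAut) • z) = c γ * discExt g z := by
    intro γ z
    rw [← discExt_comp_smul (hg.mono le_top), ← discExt_const_mul]
    exact discExt_congr_ae (hc γ) z
  -- The constant is read off at the single point `z₀`; continuity and multiplicativity in `γ` both
  -- come from this formula.
  have hval : ∀ γ : Γ, (c γ : ℂ) = discExt g ((γ : DiscAut) • z₀) / discExt g z₀ := fun γ => by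
    rw [hdisc, mul_div_cancel_right₀ _ hz₀]
  have hcont : Continuous c := by
    refine continuous_induced_rng.mpr ?_
    have h1 : Continuous fun γ : Γ => discExt g ((γ : DiscAut) • z₀) / discExt g z₀ :=
      (((continuous_discExt (hg.integrable le_top)).comp
        (DiscAut.continuous_smul_point z₀)).comp continuous_subtype_val).div_const _
    exact h1.congr fun γ => (hval γ).symm
  refine ⟨⟨MonoidHom.mk' c fun γ δ => ?_, hcont⟩, hg, hc⟩
  refine Circle.ext ?_
  rw [Circle.coe_mul, hval (γ * δ), Subgroup.coe_mul, mul_smul, hdisc, hdisc, ← mul_assoc,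
    mul_div_cancel_right₀ _ hz₀]

end CharAut

end

/-! ### Assembling the three characters -/

theorem proposition2p2 (Γ : Subgroup CharAut.DiscAut) (σ : Γ →ₜ* Circle)
    (p q : ℝ≥0∞) (hp : 1 ≤ p) [Fact (1 ≤ q)] (f B s u : Circle → ℂ)
    (hf : CharAut.MemCharHardy p σ f)
    (hB : CharAut.IsBlaschkeProduct B)
    (hs : CharAut.IsSingularInner s)
    (hu : CharAut.IsOuter q u)
    (hfac : f =ᵐ[CharAut.circleMeasure] fun ζ => B ζ * s ζ * u ζ) :
    ∃ σ₁ σ₂ σ₃ : Γ →ₜ* Circle, σ = σ₁ * σ₂ * σ₃ ∧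
      CharAut.MemCharHardy ∞ σ₁ B ∧
      CharAut.MemCharHardy 1 σ₂ u ∧
      CharAut.MemCharHardy ∞ σ₃ s := by
  have hB1 := hB.norm_ae_eq_one
  have hs1 := hs.2.1
  have hprod : ∀ γ : Γ, ∀ᵐ ζ ∂CharAut.circleMeasure,
      B ((γ : CharAut.DiscAut) • ζ) * s ((γ : CharAut.DiscAut) • ζ) * u ((γ : CharAut.DiscAut) • ζ)
        = σ γ * (B ζ * s ζ * u ζ) := fun γ => by
    filter_upwards [hf.2 γ, hfac, CharAut.ae_smul γ hfac] with ζ h1 h2 h3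
    rw [← h3, h1, h2]
  have hinner : ∀ γ : Γ, ∃ e : Circle, ∀ᵐ ζ ∂CharAut.circleMeasure,
      B ((γ : CharAut.DiscAut) • ζ) * s ((γ : CharAut.DiscAut) • ζ) = e * (B ζ * s ζ) := fun γ => by
    refine CharAut.exists_comp_smul_ae_eq (Φ := fun ζ => B ζ * s ζ) hu (hB.1.1.1.mul hs.1.1.1) ?_
      γ (hprod γ) (hprod γ⁻¹)
    filter_upwards [hB1, hs1] with ζ h1 h2
    rw [norm_mul, h1, h2, one_mul]
  have hBγ : ∀ γ : Γ, ∃ d : Circle, ∀ᵐ ζ ∂CharAut.circleMeasure,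
      B ((γ : CharAut.DiscAut) • ζ) = d * B ζ := fun γ => by
    obtain ⟨e, he⟩ := hinner γ
    exact hB.exists_comp_smul_ae_eq hs γ he
  have hsγ : ∀ γ : Γ, ∃ d : Circle, ∀ᵐ ζ ∂CharAut.circleMeasure,
      s ((γ : CharAut.DiscAut) • ζ) = d * s ζ := fun γ => by
    obtain ⟨e, he⟩ := hinner γ
    obtain ⟨d, hd⟩ := hBγ γ
    refine ⟨e / d, ?_⟩
    filter_upwards [he, hd, hB1] with ζ h1 h2 h3
    have h4 : B ζ ≠ 0 := norm_ne_zero_iff.mp (by rw [h3]; exact one_ne_zero)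
    have h5 := d.coe_ne_zero
    rw [h2] at h1
    rw [Circle.coe_div]
    field_simp
    refine mul_left_cancel₀ h4 ?_
    linear_combination h1
  obtain ⟨z₀, hz₀⟩ := hB.exists_discExt_ne_zero
  obtain ⟨σ₁, hσ₁⟩ := CharAut.exists_character hB.1 hz₀ hBγ
  obtain ⟨σ₃, hσ₃⟩ := CharAut.exists_character hs.1 (hs.2.2 0) hsγ
  -- Additively, the character of `u` is `σ - σ₁ - σ₃`; its transformation law follows by cancelling
  -- `B s`, nonzero a.e.
  refine ⟨σ₁, σ * (σ₁ * σ₃)⁻¹, σ₃, ?_, hσ₁, ⟨hu.1.mono Fact.out, fun γ => ?_⟩, hσ₃⟩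
  · rw [mul_right_comm, mul_comm σ, mul_inv_cancel_left]
  · filter_upwards [hprod γ, hσ₁.2 γ, hσ₃.2 γ, hB1, hs1] with ζ h1 h2 h3 h4 h5
    have h6 : B ζ ≠ 0 := norm_ne_zero_iff.mp (by rw [h4]; exact one_ne_zero)
    have h7 : s ζ ≠ 0 := norm_ne_zero_iff.mp (by rw [h5]; exact one_ne_zero)
    have h8 := (σ₁ γ).coe_ne_zero
    have h9 := (σ₃ γ).coe_ne_zero
    have h10 : (((σ * (σ₁ * σ₃)⁻¹) γ : Circle) : ℂ) = σ γ * (σ₁ γ * σ₃ γ : ℂ)⁻¹ := by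
      rw [← Circle.coe_mul, ← Circle.coe_inv, ← Circle.coe_mul]
      rfl
    rw [h2, h3] at h1
    rw [h10]
    field_simp
    refine mul_left_cancel₀ (mul_ne_zero h6 h7) ?_
    linear_combination h1
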